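/- Let $\Lambda$ be a standard Borel space (for instance a relatively compact Borel subset of $\mathbb R^d$) with a $\sigma$-finite reference measure $\nu$, and write $\nu(dx_{1:n})=\nu(dx_1)\cdots\nu(dx_n)$. A finite point process on $\Lambda$ is a random finite configuration, i.e. a random finite sum of Dirac masses $\{x_1,\dots,x_n\}=\delta_{x_1}+\cdots+\delta_{x_n}$. Symmetric measurable functions $j^{(n)}_\Phi:\Lambda^n\to[0,\infty]$, $n\ge 0$, are Janossy densities of $\Phi$ if $$E[F(\Phi)]=\sum_{n\ge0}\frac1{n!}\int_{\Lambda^n}F(\{x_1,\dots,x_n\})\,j^{(n)}_\Phi(x_{1:n})\,\nu(dx_{1:n})$$ for all measurable $F\ge0$. Functions $j^{(n,m)}_{\Phi,\Xi=z_{1:m}}(x_{1:n})$, measurable in $(x_{1:n},z_{1:m})$ and symmetric in $x_{1:n}$ and in $z_{1:m}$, are joint Janossy densities of $(\Phi,\Xi)$ if for all measurable $F\ge 0$ $$E[F(\Phi,\Xi)]=\sum_{n,m\ge0}\frac1{n!\,m!}\int_{\Lambda^n}\int_{\Lambda^m}F(\{x_1,\dots,x_n\},\{z_1,\dots,z_m\})\,j^{(n,m)}_{\Phi,\Xi=z_{1:m}}(x_{1:n})\,\nu(dz_{1:m})\,\nu(dx_{1:n}).$$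 Functions $j^{(n)}_{\Phi\mid\Xi=z_{1:m}}(x_{1:n})$, measurable in $(x_{1:n},z_{1:m})$ and symmetric in $x_{1:n}$, are conditional Janossy densities of $\Phi$ given $\Xi$ if, for every measurable set $A$ of configurations, almost surely, whenever $\Xi=\{z_1,\dots,z_m\}$, $$P(\Phi\in A\mid\Xi)=\sum_{n\ge0}\frac1{n!}\int_{\Lambda^n}\mathbf 1_A(\{x_1,\dots,x_n\})\,j^{(n)}_{\Phi\mid\Xi=z_{1:m}}(x_{1:n})\,\nu(dx_{1:n}).$$ Let $\Phi$ be a finite point process on $\Lambda$ with Janossy densities $j^{(n)}_\Phi$. Let $p_d\in[0,1]$, $q_d=1-p_d$; let $l_d(z|x)\ge 0$ be jointly measurable with $\int_\Lambda l_d(z|x)\,\nu(dz)=1$ for all $x$, and put $\tilde l_d(z|x)=p_d\,l_d(z|x)$; let $l_c\ge0$ be measurable with $\int_\Lambda l_c\,d\nu<\infty$. Let $\Xi$ be the superposition $\Xi=\Xi_s+\Xi_c$, where $\Xi_s$ is obtained from $\Phi$ by independently keeping each point $x$ of $\Phi$ with probability $p_d$ and moving every kept point $x$ to a random position with density $l_d(\cdot|x)$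 with respect to $\nu$, and where $\Xi_c$ is a Poisson point process with intensity function $l_c$ with respect to $\nu$, independent of $(\Phi,\Xi_s)$. **Lemma.** Conditional Janossy densities of $\Phi$ given $\Xi=z_{1:m}$ are $$j^{(n)}_{\Phi\mid\Xi=z_{1:m}}(x_{1:n})=\frac{j^{(n,m)}_{\Phi,\Xi=z_{1:m}}(x_{1:n})}{j^{(m)}_\Xi(z_{1:m})},\qquad m,n\ge0,$$ where (i) joint Janossy densities of $(\Phi,\Xi)$ are given by $$j^{(n,m)}_{\Phi,\Xi=z_{1:m}}(x_{1:n})=j^{(n)}_\Phi(x_{1:n})\,e^{-\int_\Lambda l_c\,d\nu}\sum_{S\subset\{1,\dots,m\},\ |S|\le n}q_d^{\,n-|S|}\prod_{j\notin S}l_c(z_j)\sum_{\pi:S\to\{1,\dots,n\}}\ \prod_{i\in S}\tilde l_d(z_i|x_{\pi(i)}),$$ the inner sum being over all injective maps $\pi$; and (ii) Janossy densities of $\Xi$ are given by $$j^{(m)}_\Xi(z_{1:m})=e^{-\int_\Lambda l_c\,d\nu}\sum_{n\ge0}\ \sum_{S\subset\{1,\dots,m\},\ |S|\le n}\ \prod_{j\notin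 S}l_c(z_j)\,\frac{q_d^{\,n-|S|}}{(n-|S|)!}\int_{\Lambda^n}j^{(n)}_\Phi(x_{1:n})\prod_{k=1}^{|S|}\tilde l_d(z_{S(k)}|x_k)\,\nu(dx_{1:n}),$$ where $S(1)<\cdots<S(|S|)$ are the elements of $S$. -/

import Mathlib

open MeasureTheory ProbabilityTheory
open scoped ENNReal NNReal Nat

noncomputable section

namespace PosteriorJanossy

variable {Ω E : Type*} [MeasurableSpace Ω] [MeasurableSpace E]

/-- The finite configuration `δ_{x_1} + ⋯ + δ_{x_n}` with points `x_1, …, x_n`, as a counting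
measure; a repeated point is counted with its multiplicity. -/
def config {n : ℕ} (x : Fin n → E) : Measure E :=
  ∑ i, Measure.dirac (x i)

/-- A finite point process on `E`: a random measure whose values are finite configurations. -/
structure IsPointProcess (P : Measure Ω) (Φ : Ω → Measure E) : Prop where
  measurable : Measurable Φ
  counting : ∀ᵐ ω ∂P, ∃ (n : ℕ) (x : Fin n → E), Φ ω = config x

/-- `∑_n (1 / n!) ∫ F({x_1, …, x_n}) j^{(n)}(x_1, …, x_n) ν(dx_1) ⋯ ν(dx_n)`.  The term `n = 0`
is `F(∅) j^{(0)}`. -/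
def janossyExpectation (ν : Measure E) (j : ∀ n : ℕ, (Fin n → E) → ℝ≥0∞)
    (F : Measure E → ℝ≥0∞) : ℝ≥0∞ :=
  ∑' n : ℕ, ((n ! : ℕ) : ℝ≥0∞)⁻¹ *
    ∫⁻ x : Fin n → E, F (config x) * j n x ∂(Measure.pi fun _ : Fin n => ν)

/-- `j` is a family of Janossy densities of the point process `Φ` with respect to `ν`. -/
structure HasJanossyDensities (P : Measure Ω) (ν : Measure E) (Φ : Ω → Measure E)
    (j : ∀ n : ℕ, (Fin n → E) → ℝ≥0∞) : Prop where
  measurable : ∀ n, Measurable (j n)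
  symmetric : ∀ (n : ℕ) (σ : Equiv.Perm (Fin n)) (x : Fin n → E), j n (x ∘ σ) = j n x
  expectation : ∀ F : Measure E → ℝ≥0∞, Measurable F →
    ∫⁻ ω, F (Φ ω) ∂P = janossyExpectation ν j F

/-- `J n m x z` is a family of joint Janossy densities of the pair `(Φ, Ξ)` with respect to `ν`,
the points `x` being those of `Φ` and the points `z` those of `Ξ`. -/
structure HasJointJanossyDensities (P : Measure Ω) (ν : Measure E) (Φ Ξ : Ω → Measure E)
    (J : ∀ n m : ℕ, (Fin n → E) → (Fin m → E) → ℝ≥0∞) : Prop where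
  measurable : ∀ n m, Measurable (Function.uncurry (J n m))
  symmetric : ∀ (n m : ℕ) (σ : Equiv.Perm (Fin n)) (τ : Equiv.Perm (Fin m))
    (x : Fin n → E) (z : Fin m → E), J n m (x ∘ σ) (z ∘ τ) = J n m x z
  expectation : ∀ F : Measure E × Measure E → ℝ≥0∞, Measurable F →
    ∫⁻ ω, F (Φ ω, Ξ ω) ∂P =
      ∑' n : ℕ, ∑' m : ℕ, (((n ! : ℕ) : ℝ≥0∞) * ((m ! : ℕ) : ℝ≥0∞))⁻¹ *
        ∫⁻ x : Fin n → E, ∫⁻ z : Fin m → E, F (config x, config z) * J n m x z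
          ∂(Measure.pi fun _ : Fin m => ν) ∂(Measure.pi fun _ : Fin n => ν)

/-- `jc n m x z` is a family of conditional Janossy densities of `Φ` given `Ξ = z_{1:m}`: for almost
every outcome, if `Ξ` is the configuration `{z_1, …, z_m}`, then the conditional probability of
`Φ ∈ A` given `Ξ` is the probability of `A` under the law on configurations whose Janossy densities
are `x ↦ jc n m x z`, `n ≥ 0`.  For `A = univ` this says that these densities are normalized. -/
structure HasCondJanossyDensities (P : Measure Ω) (ν : Measure E) (Φ Ξ : Ω → Measure E)
    (jc : ∀ n m : ℕ, (Fin n → E) → (Fin m → E) → ℝ≥0∞) : Prop where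
  measurable : ∀ n m, Measurable (Function.uncurry (jc n m))
  symmetric : ∀ (n m : ℕ) (σ : Equiv.Perm (Fin n)) (x : Fin n → E) (z : Fin m → E),
    jc n m (x ∘ σ) z = jc n m x z
  condProb : ∀ A : Set (Measure E), MeasurableSet A →
    ∀ᵐ ω ∂P, ∀ (m : ℕ) (z : Fin m → E), Ξ ω = config z →
      (P⟦Φ ⁻¹' A | MeasurableSpace.comap Ξ inferInstance⟧) ω =
        (janossyExpectation ν (fun n x => jc n m x z) (A.indicator fun _ => 1)).toReal

/-- A Poisson point process with finite intensity measure `μ`: the number of points in `B` is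
Poisson distributed with mean `μ B`, and the numbers of points in disjoint sets are independent. -/
structure IsPoissonProcess (P : Measure Ω) (μ : Measure E) (Ξc : Ω → Measure E) : Prop where
  isPointProcess : IsPointProcess P Ξc
  count : ∀ B : Set E, MeasurableSet B →
    P.map (fun ω => Ξc ω B) = (poissonMeasure (μ B).toNNReal).map (Nat.cast : ℕ → ℝ≥0∞)
  indep : ∀ (k : ℕ) (B : Fin k → Set E), (∀ i, MeasurableSet (B i)) →
    Pairwise (Function.onFun Disjoint B) → iIndepFun (fun i ω => Ξc ω (B i)) P

/-- The law of the Bernoulli point process generated by a target at `x`: empty with probability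
`1 - p`, and with probability `p` a single point with density `l · x` with respect to `ν`. -/
def detectionLaw (ν : Measure E) (p : ℝ≥0∞) (l : E → E → ℝ≥0∞) (x : E) : Measure (Measure E) :=
  (1 - p) • Measure.dirac 0 + p • (ν.withDensity fun z => l z x).map Measure.dirac

/-- The law of the superposition of independent Bernoulli point processes generated by targets at
`x_1, …, x_n`. -/
def thinnedShiftedLaw (ν : Measure E) (p : ℝ≥0∞) (l : E → E → ℝ≥0∞) {n : ℕ} (x : Fin n → E) :
    Measure (Measure E) :=
  (Measure.pi fun i => detectionLaw ν p l (x i)).map fun η : Fin n → Measure E => ∑ i, η i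

/-- `Ξs` arises from `Φ` by keeping every point `x` of `Φ` with probability `p` and moving it
according to the density `l · x`, independently of the other points: conditionally on
`Φ = {x_1, …, x_n}`, the law of `Ξs` is `thinnedShiftedLaw ν p l x`. -/
structure IsThinnedShifted (P : Measure Ω) (ν : Measure E) (p : ℝ≥0∞) (l : E → E → ℝ≥0∞)
    (Φ Ξs : Ω → Measure E) : Prop where
  isPointProcess : IsPointProcess P Ξs
  condLaw : ∃ κ : Kernel (Measure E) (Measure E), IsMarkovKernel κ ∧
    (∀ (n : ℕ) (x : Fin n → E), κ (config x) = thinnedShiftedLaw ν p l x) ∧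
    P.map (fun ω => (Φ ω, Ξs ω)) = (P.map Φ).compProd κ

/-- `Ξ` is the superposition of the thinned and shifted process `Φ` and of a Poisson clutter process
with intensity function `lc`, independent of the rest. -/
def IsMeasurementProcess (P : Measure Ω) (ν : Measure E) (p : ℝ≥0∞) (l : E → E → ℝ≥0∞)
    (lc : E → ℝ≥0∞) (Φ Ξ : Ω → Measure E) : Prop :=
  ∃ Ξs Ξc : Ω → Measure E,
    IsThinnedShifted P ν p l Φ Ξs ∧
    IsPoissonProcess P (ν.withDensity lc) Ξc ∧
    IndepFun (fun ω => (Φ ω, Ξs ω)) Ξc P ∧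
    ∀ ω, Ξ ω = Ξs ω + Ξc ω

/-- `exp(-∫ lc dν)`, the probability that there is no clutter. -/
def noClutter (ν : Measure E) (lc : E → ℝ≥0∞) : ℝ≥0∞ :=
  ENNReal.ofReal (Real.exp (-(∫⁻ y, lc y ∂ν).toReal))

/-- `j^{(n)}(x_{1:n}) exp(-∫ lc dν) ∑_{S ⊆ {1,…,m}, |S| ≤ n} (1-p)^{n-|S|} ∏_{j ∉ S} lc(z_j)
∑_{π : S ↪ {1,…,n}} ∏_{i ∈ S} p l(z_i | x_{π(i)})`. -/
def jointJanossy (ν : Measure E) (p : ℝ≥0∞) (l : E → E → ℝ≥0∞) (lc : E → ℝ≥0∞)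
    (j : ∀ n : ℕ, (Fin n → E) → ℝ≥0∞) (n m : ℕ) (x : Fin n → E) (z : Fin m → E) : ℝ≥0∞ :=
  j n x * (noClutter ν lc *
    ∑ S : {S : Finset (Fin m) // S.card ≤ n},
      (1 - p) ^ (n - S.1.card) * (∏ k ∈ S.1ᶜ, lc (z k)) *
        ∑ π : S.1 ↪ Fin n, ∏ i : S.1, p * l (z i) (x (π i)))

/-- `exp(-∫ lc dν) ∑_n ∑_{S ⊆ {1,…,m}, |S| ≤ n} ∏_{j ∉ S} lc(z_j) ((1-p)^{n-|S|} / (n-|S|)!)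
∫ j^{(n)}(x_{1:n}) ∏_{k=1}^{|S|} p l(z_{S(k)} | x_k) ν(dx_{1:n})`, with `S(1) < ⋯ < S(|S|)` the
elements of `S`. -/
def measurementJanossy (ν : Measure E) (p : ℝ≥0∞) (l : E → E → ℝ≥0∞) (lc : E → ℝ≥0∞)
    (j : ∀ n : ℕ, (Fin n → E) → ℝ≥0∞) (m : ℕ) (z : Fin m → E) : ℝ≥0∞ :=
  noClutter ν lc * ∑' n : ℕ,
    ∑ S : {S : Finset (Fin m) // S.card ≤ n},
      (∏ k ∈ S.1ᶜ, lc (z k)) *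
        ((1 - p) ^ (n - S.1.card) / (((n - S.1.card)! : ℕ) : ℝ≥0∞)) *
        ∫⁻ x : Fin n → E, j n x *
          ∏ k : Fin S.1.card, p * l (z (S.1.orderEmbOfFin rfl k)) (x (Fin.castLE S.2 k))
          ∂(Measure.pi fun _ : Fin n => ν)

end PosteriorJanossy

end

noncomputable section

namespace PosteriorJanossy

section Assignment

variable {R : Type*} [CommSemiring R] {n m : ℕ}

/-- A partial injection from measurements to targets: no target generates two measurements. -/
def IsAssignment (f : Fin m → Option (Fin n)) : Prop :=
  ∀ k k' a, f k = some a → f k' = some a → k = k'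

open Classical in
/-- The weight of a partial injection: `q` for every target which is not hit, `c k` for every
unassigned measurement and `u k a` for every measurement `k` assigned to the target `a`. -/
def assignmentWeight (q : R) (c : Fin m → R) (u : Fin m → Fin n → R)
    (f : Fin m → Option (Fin n)) : R :=
  if IsAssignment f then
    (∏ a, if ∃ k, f k = some a then 1 else q) * ∏ k, (f k).elim (c k) (u k)
  else 0

/-- The total weight of all partial injections. -/
def assignmentSum (q : R) (c : Fin m → R) (u : Fin m → Fin n → R) : R :=
  ∑ f : Fin m → Option (Fin n), assignmentWeight q c u f

theorem assignmentWeight_of_not (q : R) (c : Fin m → R) (u : Fin m → Fin n → R)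
    {f : Fin m → Option (Fin n)} (hf : ¬ IsAssignment f) : assignmentWeight q c u f = 0 :=
  if_neg hf

/-- Relabelling measurements and targets does not change the total weight. -/
theorem assignmentSum_comp_perm (q : R) (c : Fin m → R) (u : Fin m → Fin n → R)
    (τ : Equiv.Perm (Fin m)) (σ : Equiv.Perm (Fin n)) :
    assignmentSum q (fun k => c (τ k)) (fun k a => u (τ k) (σ a)) = assignmentSum q c u := by
  classical
  unfold assignmentSum
  refine Fintype.sum_equiv (Equiv.arrowCongr τ (Equiv.optionCongr σ)) _ _ fun f => ?_
  have happ : ∀ k, (Equiv.arrowCongr τ (Equiv.optionCongr σ)) f k = (f (τ.symm k)).map σ :=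
    fun k => rfl
  have hsome : ∀ k a, (Equiv.arrowCongr τ (Equiv.optionCongr σ)) f k = some a ↔
      f (τ.symm k) = some (σ.symm a) := by
    intro k a
    rw [happ]
    cases f (τ.symm k) with
    | none => simp
    | some b => simp [Equiv.eq_symm_apply]
  have hiff : IsAssignment ((Equiv.arrowCongr τ (Equiv.optionCongr σ)) f) ↔ IsAssignment f := by
    unfold IsAssignment
    simp only [hsome]
    constructor
    · intro h k k' a h1 h2
      have := h (τ k) (τ k') (σ a) (by simpa using h1) (by simpa using h2)
      simpa using this
    · intro h k k' a h1 h2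
      have := h _ _ _ h1 h2
      simpa using this
  unfold assignmentWeight
  simp only [hiff]
  split_ifs with hf
  · congr 1
    · refine Fintype.prod_equiv σ _ _ fun a => ?_
      have : (∃ k, f k = some a) ↔
          ∃ k, (Equiv.arrowCongr τ (Equiv.optionCongr σ)) f k = some (σ a) := by
        simp only [hsome, Equiv.symm_apply_apply]
        exact ⟨fun ⟨k, hk⟩ => ⟨τ k, by simpa using hk⟩, fun ⟨k, hk⟩ => ⟨_, hk⟩⟩
      simp only [this]
    · refine Fintype.prod_equiv τ _ _ fun k => ?_
      rw [happ, Equiv.symm_apply_apply]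
      cases f k <;> rfl
  · rfl

theorem assignmentSum_zero (q : R) (c : Fin m → R) (u : Fin m → Fin 0 → R) :
    assignmentSum q c u = ∏ k, c k := by
  classical
  unfold assignmentSum
  rw [Fintype.sum_eq_single (fun _ => none)]
  · have h : IsAssignment fun _ : Fin m => (none : Option (Fin 0)) := fun _ _ a => a.elim0
    rw [assignmentWeight, if_pos h]
    simp
  · intro f hf
    exact absurd (funext fun k => by
      cases h : f k with
      | none => rfl
      | some a => exact a.elim0) hf

theorem isAssignment_map_succ (f : Fin m → Option (Fin n)) :
    IsAssignment (fun k => (f k).map Fin.succ) ↔ IsAssignment f := by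
  unfold IsAssignment
  simp only [Option.map_eq_some_iff]
  constructor
  · intro h k k' a h1 h2
    exact h k k' a.succ ⟨a, h1, rfl⟩ ⟨a, h2, rfl⟩
  · rintro h k k' _ ⟨a, h1, rfl⟩ ⟨b, h2, hb⟩
    exact h k k' a h1 (by rwa [Fin.succ_injective _ hb] at h2)

theorem assignmentWeight_map_succ (q : R) (c : Fin m → R) (u : Fin m → Fin (n + 1) → R)
    (f : Fin m → Option (Fin n)) :
    assignmentWeight q c u (fun k => (f k).map Fin.succ) =
      q * assignmentWeight q c (fun k a => u k a.succ) f := by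
  classical
  unfold assignmentWeight
  simp only [isAssignment_map_succ]
  split_ifs with hf
  · rw [Fin.prod_univ_succ]
    have h0 : ¬ ∃ k, (f k).map Fin.succ = some 0 := by
      rintro ⟨k, hk⟩
      obtain ⟨a, -, ha⟩ := Option.map_eq_some_iff.1 hk
      exact Fin.succ_ne_zero a ha
    have h1 : ∀ a, (∃ k, (f k).map Fin.succ = some a.succ) ↔ ∃ k, f k = some a := by
      intro a
      simp [Option.map_eq_some_iff]
    rw [if_neg h0, mul_assoc]
    simp only [h1]
    congr 2
    refine Finset.prod_congr rfl fun k _ => ?_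
    cases f k <;> rfl
  · simp

theorem isAssignment_insertNth (k : Fin (m + 1)) (f : Fin m → Option (Fin n)) :
    IsAssignment (k.insertNth (α := fun _ => Option (Fin (n + 1))) (some 0)
      fun i => (f i).map Fin.succ) ↔ IsAssignment f := by
  rw [← isAssignment_map_succ f]
  constructor
  · intro h i i' a h1 h2
    exact Fin.succAbove_right_injective (p := k)
      (h (k.succAbove i) (k.succAbove i') a (by simpa using h1) (by simpa using h2))
  · intro h i i' a
    have h0 : ∀ i, (f i).map Fin.succ ≠ some 0 := fun i hi => by
      obtain ⟨a, -, ha⟩ := Option.map_eq_some_iff.1 hi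
      exact Fin.succ_ne_zero a ha
    refine Fin.succAboveCases k ?_ (fun i => ?_) i <;>
      refine Fin.succAboveCases k ?_ (fun i' => ?_) i'
    · exact fun _ _ => rfl
    · simp only [Fin.insertNth_apply_same, Fin.insertNth_apply_succAbove]
      rintro rfl' h2
      cases rfl'
      exact absurd h2 (h0 _)
    · simp only [Fin.insertNth_apply_same, Fin.insertNth_apply_succAbove]
      rintro h2 rfl'
      cases rfl'
      exact absurd h2 (h0 _)
    · simp only [Fin.insertNth_apply_succAbove]
      exact fun h1 h2 => congrArg _ (h i i' a h1 h2)

theorem assignmentWeight_insertNth (q : R) (c : Fin (m + 1) → R)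
    (u : Fin (m + 1) → Fin (n + 1) → R) (k : Fin (m + 1)) (f : Fin m → Option (Fin n)) :
    assignmentWeight q c u (k.insertNth (α := fun _ => Option (Fin (n + 1))) (some 0)
      fun i => (f i).map Fin.succ) =
      u k 0 * assignmentWeight q (fun i => c (k.succAbove i))
        (fun i a => u (k.succAbove i) a.succ) f := by
  classical
  unfold assignmentWeight
  simp only [isAssignment_insertNth]
  split_ifs with hf
  · rw [Fin.prod_univ_succ, Fin.prod_univ_succAbove _ k]
    have h1 : ∀ a, (∃ i, k.insertNth (α := fun _ => Option (Fin (n + 1))) (some 0)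
        (fun i => (f i).map Fin.succ) i = some (Fin.succ a)) ↔ ∃ i, f i = some a := by
      intro a
      rw [Fin.exists_iff_succAbove k]
      simp [Option.map_eq_some_iff, (Fin.succ_ne_zero a).symm]
    rw [if_pos ⟨k, by simp⟩]
    simp only [h1, Fin.insertNth_apply_same, Fin.insertNth_apply_succAbove, Option.elim_some,
      one_mul]
    rw [mul_left_comm]
    congr 2
    refine Finset.prod_congr rfl fun i _ => ?_
    cases f i <;> rfl
  · simp

/-- Every map into `Option (Fin (n + 1))` avoiding `some 0` comes from `Option (Fin n)`. -/
theorem exists_map_succ_eq {ι : Type*} (f : ι → Option (Fin (n + 1))) (hf : ∀ k, f k ≠ some 0) :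
    ∃ g : ι → Option (Fin n), (fun k => (g k).map Fin.succ) = f := by
  have : ∀ k, ∃ o : Option (Fin n), o.map Fin.succ = f k := by
    intro k
    cases h : f k with
    | none => exact ⟨none, rfl⟩
    | some a =>
      have ha : a ≠ 0 := fun h0 => hf k (h0 ▸ h)
      exact ⟨some (a.pred ha), by simp⟩
  choose g hg using this
  exact ⟨g, funext hg⟩

theorem option_map_succ_comp_injective {ι : Type*} :
    Function.Injective fun (g : ι → Option (Fin n)) k => (g k).map Fin.succ := by
  intro g g' h
  funext k
  exact Option.map_injective (Fin.succ_injective n) (congrFun h k)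

open Classical in
theorem assignmentWeight_eq_add (q : R) (c : Fin m → R) (u : Fin m → Fin (n + 1) → R)
    (f : Fin m → Option (Fin (n + 1))) :
    assignmentWeight q c u f =
      (if ∀ k, f k ≠ some 0 then assignmentWeight q c u f else 0) +
        ∑ k, if f k = some 0 then assignmentWeight q c u f else 0 := by
  by_cases hf : IsAssignment f
  · by_cases h : ∀ k, f k ≠ some 0
    · rw [if_pos h, Finset.sum_eq_zero fun k _ => if_neg (h k), add_zero]
    · rw [if_neg h, zero_add]
      push Not at h
      obtain ⟨k, hk⟩ := h
      rw [Finset.sum_eq_single k, if_pos hk]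
      · exact fun k' _ hne => if_neg fun hk' => hne (hf _ _ _ hk' hk)
      · simp
  · simp [assignmentWeight_of_not q c u hf]

theorem sum_assignmentWeight_avoiding (q : R) (c : Fin m → R) (u : Fin m → Fin (n + 1) → R)
    [∀ f : Fin m → Option (Fin (n + 1)), Decidable (∀ k, f k ≠ some 0)] :
    (∑ f : Fin m → Option (Fin (n + 1)),
      if ∀ k, f k ≠ some 0 then assignmentWeight q c u f else 0) =
      q * assignmentSum q c (fun k a => u k a.succ) := by
  rw [assignmentSum, Finset.mul_sum]
  symm
  refine Fintype.sum_of_injective _ option_map_succ_comp_injective _ _ ?_ ?_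
  · intro f hf
    refine if_neg fun h => hf ?_
    obtain ⟨g, hg⟩ := exists_map_succ_eq f h
    exact ⟨g, hg⟩
  · intro f
    rw [if_pos, assignmentWeight_map_succ]
    intro k hk
    obtain ⟨a, -, ha⟩ := Option.map_eq_some_iff.1 hk
    exact Fin.succ_ne_zero a ha

theorem assignmentSum_succ_of_isEmpty (q : R) (c : Fin 0 → R) (u : Fin 0 → Fin (n + 1) → R) :
    assignmentSum q c u = q * assignmentSum q c (fun k a => u k a.succ) := by
  classical
  rw [← sum_assignmentWeight_avoiding, assignmentSum]
  refine Finset.sum_congr rfl fun f _ => ?_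
  rw [if_pos fun k => k.elim0]

/-- The first target is not detected, or generates the measurement `k`. -/
theorem assignmentSum_succ (q : R) (c : Fin (m + 1) → R) (u : Fin (m + 1) → Fin (n + 1) → R) :
    assignmentSum q c u = q * assignmentSum q c (fun k a => u k a.succ) +
      ∑ k, u k 0 * assignmentSum q (fun i => c (k.succAbove i))
        (fun i a => u (k.succAbove i) a.succ) := by
  classical
  rw [← sum_assignmentWeight_avoiding, assignmentSum,
    Finset.sum_congr rfl fun f _ => assignmentWeight_eq_add q c u f, Finset.sum_add_distrib,
    Finset.sum_comm]
  congr 1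
  refine Finset.sum_congr rfl fun k _ => ?_
  rw [assignmentSum, Finset.mul_sum]
  symm
  refine Fintype.sum_of_injective (fun f : Fin m → Option (Fin n) =>
    k.insertNth (α := fun _ => Option (Fin (n + 1))) (some 0) fun i => (f i).map Fin.succ)
    ?_ _ _ ?_ ?_
  · intro f g h
    refine option_map_succ_comp_injective (funext fun i => ?_)
    simpa using congrFun h (k.succAbove i)
  · intro f hf
    by_cases hk : f k = some 0
    · rw [if_pos hk]
      refine assignmentWeight_of_not _ _ _ fun ha => hf ?_
      obtain ⟨g, hg⟩ := exists_map_succ_eq (fun i => f (k.succAbove i)) fun i hi =>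
        Fin.succAbove_ne k i (ha _ _ _ hi hk)
      refine ⟨g, ?_⟩
      dsimp only
      rw [hg, ← hk]
      exact Fin.insertNth_self_removeNth k f
    · rw [if_neg hk]
  · intro f
    rw [if_pos (by simp), assignmentWeight_insertNth]

open Classical in
/-- The partial injection given by its domain and an embedding of the domain. -/
def assignmentOfEmbedding (x : Σ S : Finset (Fin m), (S ↪ Fin n)) (k : Fin m) : Option (Fin n) :=
  if h : k ∈ x.1 then some (x.2 ⟨k, h⟩) else none

theorem assignmentOfEmbedding_isSome (x : Σ S : Finset (Fin m), (S ↪ Fin n)) (k : Fin m) :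
    (assignmentOfEmbedding x k).isSome ↔ k ∈ x.1 := by
  unfold assignmentOfEmbedding
  split_ifs with h <;> simp [h]

theorem assignmentOfEmbedding_eq_some (x : Σ S : Finset (Fin m), (S ↪ Fin n)) (k : Fin m)
    (a : Fin n) : assignmentOfEmbedding x k = some a ↔ ∃ h : k ∈ x.1, x.2 ⟨k, h⟩ = a := by
  unfold assignmentOfEmbedding
  split_ifs with h <;> simp [h]

theorem assignmentOfEmbedding_injective :
    Function.Injective (assignmentOfEmbedding (n := n) (m := m)) := by
  rintro ⟨S, π⟩ ⟨S', π'⟩ h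
  have hS : S = S' := by
    ext k
    have h1 := assignmentOfEmbedding_isSome ⟨S, π⟩ k
    rw [h, assignmentOfEmbedding_isSome ⟨S', π'⟩ k] at h1
    exact h1.symm
  subst hS
  congr 1
  ext ⟨k, hk⟩
  have h1 : assignmentOfEmbedding ⟨S, π⟩ k = some (π ⟨k, hk⟩) :=
    (assignmentOfEmbedding_eq_some _ _ _).2 ⟨hk, rfl⟩
  rw [h] at h1
  obtain ⟨_, h2⟩ := (assignmentOfEmbedding_eq_some ⟨S, π'⟩ _ _).1 h1
  exact congrArg Fin.val h2.symm

theorem isAssignment_assignmentOfEmbedding (x : Σ S : Finset (Fin m), (S ↪ Fin n)) :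
    IsAssignment (assignmentOfEmbedding x) := by
  intro k k' a h1 h2
  obtain ⟨hk, h1⟩ := (assignmentOfEmbedding_eq_some _ _ _).1 h1
  obtain ⟨hk', h2⟩ := (assignmentOfEmbedding_eq_some _ _ _).1 h2
  simpa using x.2.injective (h1.trans h2.symm)

theorem mem_range_assignmentOfEmbedding {f : Fin m → Option (Fin n)} (hf : IsAssignment f) :
    f ∈ Set.range (assignmentOfEmbedding (n := n) (m := m)) := by
  classical
  let S : Finset (Fin m) := Finset.univ.filter fun k => (f k).isSome
  have hS : ∀ k : S, (f k).isSome := fun k => (Finset.mem_filter.1 k.2).2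
  refine ⟨⟨S, ⟨fun k => (f k).get (hS k), fun k k' h => ?_⟩⟩, ?_⟩
  · refine Subtype.ext (hf k k' ((f k).get (hS k)) (Option.some_get _).symm ?_)
    dsimp only at h
    rw [h, Option.some_get]
  · funext k
    unfold assignmentOfEmbedding
    split_ifs with h
    · exact Option.some_get _
    · have : ¬ (f k).isSome := fun hk => h (Finset.mem_filter.2 ⟨Finset.mem_univ _, hk⟩)
      exact (Option.not_isSome_iff_eq_none.1 this).symm

theorem assignmentWeight_assignmentOfEmbedding (q : R) (c : Fin m → R) (u : Fin m → Fin n → R)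
    (S : Finset (Fin m)) (π : S ↪ Fin n) :
    assignmentWeight q c u (assignmentOfEmbedding ⟨S, π⟩) =
      q ^ (n - S.card) * (∏ k ∈ Sᶜ, c k) * ∏ i : S, u i (π i) := by
  classical
  rw [assignmentWeight, if_pos (isAssignment_assignmentOfEmbedding _), mul_assoc]
  congr 1
  · rw [Finset.prod_ite, Finset.prod_const_one, one_mul, Finset.prod_const]
    congr 1
    have h : (Finset.univ.filter fun a : Fin n =>
        ¬ ∃ k, assignmentOfEmbedding ⟨S, π⟩ k = some a) = (Finset.univ.map π)ᶜ := by
      ext a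
      simp [assignmentOfEmbedding_eq_some]
    rw [h, Finset.card_compl]
    simp
  · rw [← Finset.prod_compl_mul_prod S, ← Finset.prod_coe_sort S]
    congr 1
    · refine Finset.prod_congr rfl fun k hk => ?_
      rw [Finset.mem_compl] at hk
      simp [assignmentOfEmbedding, hk]
    · refine Finset.prod_congr rfl fun k _ => ?_
      simp [assignmentOfEmbedding]

theorem sum_subset_embedding_eq_assignmentSum (q : R) (c : Fin m → R) (u : Fin m → Fin n → R) :
    ∑ S : {S : Finset (Fin m) // S.card ≤ n}, q ^ (n - S.1.card) * (∏ k ∈ S.1ᶜ, c k) *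
      ∑ π : S.1 ↪ Fin n, ∏ i : S.1, u i (π i) = assignmentSum q c u := by
  classical
  have h1 : ∑ S : {S : Finset (Fin m) // S.card ≤ n}, q ^ (n - S.1.card) * (∏ k ∈ S.1ᶜ, c k) *
      ∑ π : S.1 ↪ Fin n, ∏ i : S.1, u i (π i) =
      ∑ S : Finset (Fin m), q ^ (n - S.card) * (∏ k ∈ Sᶜ, c k) *
        ∑ π : S ↪ Fin n, ∏ i : S, u i (π i) := by
    refine Fintype.sum_of_injective Subtype.val Subtype.val_injective _ _ ?_ fun _ => rfl
    intro S hS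
    have : IsEmpty (S ↪ Fin n) := ⟨fun π => hS ⟨⟨S, by
      simpa using Fintype.card_le_of_embedding π⟩, rfl⟩⟩
    simp
  rw [h1]
  simp only [Finset.mul_sum, ← assignmentWeight_assignmentOfEmbedding]
  rw [← Fintype.sum_sigma' (fun S π => assignmentWeight q c u (assignmentOfEmbedding ⟨S, π⟩)),
    assignmentSum]
  refine Fintype.sum_of_injective _ assignmentOfEmbedding_injective _ _ ?_ fun _ => rfl
  intro f hf
  exact assignmentWeight_of_not _ _ _ fun h => hf (mem_range_assignmentOfEmbedding h)

end Assignment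

section Basic

variable {E : Type*} [MeasurableSpace E]

@[fun_prop]
theorem measurable_config {n : ℕ} : Measurable (config : (Fin n → E) → Measure E) :=
  Finset.measurable_fun_sum _ fun i _ => Measure.measurable_dirac.comp (measurable_pi_apply i)

theorem config_apply {n : ℕ} (x : Fin n → E) {B : Set E} (hB : MeasurableSet B) :
    config x B = ∑ i, B.indicator 1 (x i) := by
  simp [config, Measure.dirac_apply' _ hB]

theorem config_univ {n : ℕ} (x : Fin n → E) : config x Set.univ = n := by
  simp [config_apply x MeasurableSet.univ]

theorem config_insertNth {n : ℕ} (k : Fin (n + 1)) (w : E) (z : Fin n → E) :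
    config (k.insertNth (α := fun _ => E) w z) = Measure.dirac w + config z := by
  simp [config, Fin.sum_univ_succAbove _ k]

end Basic

section CountDetermination

variable {E : Type*} [MeasurableSpace E]

theorem measurable_counts {ι : Type*} {B : ι → Set E} (hB : ∀ i, MeasurableSet (B i)) :
    Measurable fun (ξ : Measure E) i => ξ (B i) :=
  measurable_pi_lambda _ fun i => Measure.measurable_coe (hB i)

/-- The joint law of the numbers of points in arbitrary sets is determined by the joint laws of the
numbers of points in disjoint sets. -/
theorem map_counts_eq_of_disjoint {L L' : Measure (Measure E)}
    (h : ∀ (k : ℕ) (B : Fin k → Set E), (∀ i, MeasurableSet (B i)) →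
      Pairwise (Function.onFun Disjoint B) →
      L.map (fun ξ i => ξ (B i)) = L'.map fun ξ i => ξ (B i))
    {ι : Type*} [Finite ι] {B : ι → Set E} (hB : ∀ i, MeasurableSet (B i)) :
    L.map (fun ξ i => ξ (B i)) = L'.map fun ξ i => ξ (B i) := by
  classical
  have := Fintype.ofFinite ι
  let b : E → ι → Bool := fun w i => decide (w ∈ B i)
  have hb : Measurable b := measurable_pi_lambda _ fun i => by
    refine measurable_to_bool ?_
    convert hB i using 1
    ext w
    simp [b]
  let e := Fintype.equivFin (ι → Bool)
  let A : Fin (Fintype.card (ι → Bool)) → Set E := fun r => b ⁻¹' {e.symm r}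
  have hA : ∀ r, MeasurableSet (A r) := fun r => hb (measurableSet_singleton _)
  have hdisj : Pairwise (Function.onFun Disjoint A) := fun r r' hr => by
    refine Disjoint.preimage _ ?_
    simpa using hr
  let T : (Fin (Fintype.card (ι → Bool)) → ℝ≥0∞) → ι → ℝ≥0∞ := fun v i =>
    ∑ s ∈ Finset.univ.filter fun s : ι → Bool => s i = true, v (e s)
  have hT : Measurable T := by
    unfold T
    fun_prop
  have hcounts : (fun (ξ : Measure E) i => ξ (B i)) = T ∘ fun ξ r => ξ (A r) := by
    funext ξ i
    simp only [T, A, Function.comp, Equiv.symm_apply_apply]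
    rw [sum_measure_preimage_singleton _ fun s _ => hb (measurableSet_singleton _)]
    congr 1
    ext w
    simp [b]
  rw [hcounts, ← Measure.map_map hT (measurable_counts hA), h _ A hA hdisj,
    Measure.map_map hT (measurable_counts hA)]

/-- The law of a random measure is determined by the joint laws of the masses of disjoint sets. -/
theorem measure_ext_of_map_counts {L L' : Measure (Measure E)} [IsProbabilityMeasure L]
    [IsProbabilityMeasure L']
    (h : ∀ (k : ℕ) (B : Fin k → Set E), (∀ i, MeasurableSet (B i)) →
      Pairwise (Function.onFun Disjoint B) →
      L.map (fun ξ i => ξ (B i)) = L'.map fun ξ i => ξ (B i)) : L = L' := by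
  let m : Set E → MeasurableSpace (Measure E) := fun s =>
    (borel ℝ≥0∞).comap fun ξ : Measure E => ξ s
  refine ext_of_generate_finite _
    (generateFrom_piiUnionInter_measurableSet m {s | MeasurableSet s}).symm
    (isPiSystem_piiUnionInter _ (fun s => @MeasurableSpace.isPiSystem_measurableSet _ (m s)) _)
    ?_ (by simp)
  rintro _ ⟨t, ht, f, hf, rfl⟩
  have hC : ∀ s : t, ∃ C, MeasurableSet C ∧ (fun ξ : Measure E => ξ s) ⁻¹' C = f s := by
    intro s
    obtain ⟨C, hC, hC'⟩ := hf s s.2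
    exact ⟨C, (BorelSpace.measurable_eq (α := ℝ≥0∞)) ▸ hC, hC'⟩
  choose C hC hCf using hC
  have hB : ∀ s : t, MeasurableSet (s : Set E) := fun s => ht s.2
  have key : (⋂ s ∈ t, f s) = (fun (ξ : Measure E) (s : t) => ξ s) ⁻¹' Set.univ.pi C := by
    ext ξ
    simp only [Set.mem_iInter, Set.mem_preimage, Set.mem_univ_pi]
    constructor
    · intro hξ s
      have := hξ s s.2
      rwa [← hCf] at this
    · intro hξ s hs
      have := hξ ⟨s, hs⟩
      rwa [← hCf ⟨s, hs⟩]
  have hm := MeasurableSet.univ_pi hC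
  rw [key, ← Measure.map_apply (measurable_counts hB) hm, map_counts_eq_of_disjoint h hB,
    Measure.map_apply (measurable_counts hB) hm]

end CountDetermination

section Poisson

variable {E : Type*} [MeasurableSpace E]

/-- The law of the Poisson point process with finite intensity measure `μ`. -/
def poissonLaw (μ : Measure E) : Measure (Measure E) :=
  ENNReal.ofReal (Real.exp (-(μ Set.univ).toReal)) •
    Measure.sum fun n : ℕ => ((n ! : ℕ) : ℝ≥0∞)⁻¹ • (Measure.pi fun _ : Fin n => μ).map config

theorem lintegral_poissonLaw (μ : Measure E) {F : Measure E → ℝ≥0∞} (hF : Measurable F) :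
    ∫⁻ ξ, F ξ ∂(poissonLaw μ) = ENNReal.ofReal (Real.exp (-(μ Set.univ).toReal)) *
      ∑' n : ℕ, ((n ! : ℕ) : ℝ≥0∞)⁻¹ *
        ∫⁻ z : Fin n → E, F (config z) ∂(Measure.pi fun _ : Fin n => μ) := by
  simp [poissonLaw, lintegral_sum_measure, lintegral_map hF measurable_config]

theorem tsum_inv_factorial_mul_pow (r : ℝ≥0) :
    ∑' n : ℕ, ((n ! : ℕ) : ℝ≥0∞)⁻¹ * (r : ℝ≥0∞) ^ n = ENNReal.ofReal (Real.exp r) := by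
  have h := NormedSpace.expSeries_div_hasSum_exp (r : ℝ)
  rw [← Real.exp_eq_exp_ℝ] at h
  rw [← h.tsum_eq, ENNReal.ofReal_tsum_of_nonneg (fun n => by positivity) h.summable]
  refine tsum_congr fun n => ?_
  rw [ENNReal.ofReal_div_of_pos (by positivity), ENNReal.ofReal_pow (by positivity),
    ENNReal.ofReal_coe_nnreal, ENNReal.ofReal_natCast, ENNReal.div_eq_inv_mul]

instance isProbabilityMeasure_poissonLaw (μ : Measure E) [IsFiniteMeasure μ] :
    IsProbabilityMeasure (poissonLaw μ) := by
  constructor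
  rw [← lintegral_one, lintegral_poissonLaw μ measurable_const]
  have h : μ Set.univ = ((μ Set.univ).toNNReal : ℝ≥0∞) := by simp
  simp only [lintegral_one, Measure.pi_univ, Finset.prod_const, Finset.card_univ, Fintype.card_fin]
  rw [h, tsum_inv_factorial_mul_pow, ← ENNReal.ofReal_mul (by positivity), ← Real.exp_add,
    ENNReal.coe_toNNReal_eq_toReal, ← h, neg_add_cancel, Real.exp_zero, ENNReal.ofReal_one]

theorem ae_poissonLaw_univ_lt_top (μ : Measure E) [IsFiniteMeasure μ] :
    ∀ᵐ ξ ∂(poissonLaw μ), ξ Set.univ < ∞ := by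
  refine Measure.ae_smul_measure ?_ _
  rw [Measure.ae_sum_iff]
  intro n
  refine Measure.ae_smul_measure ?_ _
  rw [ae_map_iff measurable_config.aemeasurable
    (measurableSet_lt (Measure.measurable_coe MeasurableSet.univ) measurable_const)]
  exact Filter.Eventually.of_forall fun z => by simp [config_univ]

theorem integral_poissonLaw (μ : Measure E) [IsFiniteMeasure μ] {g : Measure E → ℂ}
    (hg : Integrable g (poissonLaw μ)) (hgm : Measurable g) :
    ∫ ξ, g ξ ∂(poissonLaw μ) = Real.exp (-(μ Set.univ).toReal) *
      ∑' n : ℕ, ((n ! : ℕ) : ℂ)⁻¹ *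
        ∫ z : Fin n → E, g (config z) ∂(Measure.pi fun _ : Fin n => μ) := by
  unfold poissonLaw at hg ⊢
  have hpos : ENNReal.ofReal (Real.exp (-(μ Set.univ).toReal)) ≠ 0 := by positivity
  rw [integrable_smul_measure hpos ENNReal.ofReal_ne_top] at hg
  rw [integral_smul_measure, integral_sum_measure hg, ENNReal.toReal_ofReal (by positivity),
    Complex.real_smul]
  congr 1
  refine tsum_congr fun n => ?_
  rw [integral_smul_measure, integral_map measurable_config.aemeasurable
    hgm.aestronglyMeasurable, Complex.real_smul]
  simp

theorem integral_exp_sum_indicator (μ : Measure E) [IsFiniteMeasure μ] {k : ℕ} (B : Fin k → Set E)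
    (hB : ∀ i, MeasurableSet (B i)) (hd : Pairwise (Function.onFun Disjoint B)) (t : Fin k → ℝ) :
    ∫ w, Complex.exp ((∑ i, (B i).indicator (fun _ => (t i : ℂ)) w) * Complex.I) ∂μ =
      μ.real Set.univ + ∑ i, μ.real (B i) * (Complex.exp (t i * Complex.I) - 1) := by
  have h : ∀ w, Complex.exp ((∑ i, (B i).indicator (fun _ => (t i : ℂ)) w) * Complex.I) =
      1 + ∑ i, (B i).indicator (fun _ => Complex.exp (t i * Complex.I) - 1) w := by
    intro w
    by_cases hw : ∃ i, w ∈ B i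
    · obtain ⟨i, hi⟩ := hw
      have hne : ∀ i', i' ≠ i → w ∉ B i' := fun i' hne hi' =>
        Set.disjoint_left.1 (hd hne) hi' hi
      rw [Finset.sum_eq_single i (fun i' _ h => Set.indicator_of_notMem (hne i' h) _) (by simp),
        Finset.sum_eq_single i (fun i' _ h => Set.indicator_of_notMem (hne i' h) _) (by simp),
        Set.indicator_of_mem hi, Set.indicator_of_mem hi]
      ring
    · push Not at hw
      rw [Finset.sum_eq_zero fun i _ => Set.indicator_of_notMem (hw i) _,
        Finset.sum_eq_zero fun i _ => Set.indicator_of_notMem (hw i) _]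
      simp
  simp only [h]
  have hint : ∀ i, Integrable ((B i).indicator fun _ => Complex.exp (t i * Complex.I) - 1) μ :=
    fun i => (integrable_const _).indicator (hB i)
  rw [integral_add (integrable_const _) (integrable_finsetSum _ fun i _ => hint i),
    integral_finsetSum _ fun i _ => hint i]
  simp [integral_indicator_const _ (hB _)]

theorem map_toReal_counts_poissonLaw (μ : Measure E) [IsFiniteMeasure μ] {k : ℕ}
    (B : Fin k → Set E) (hB : ∀ i, MeasurableSet (B i))
    (hd : Pairwise (Function.onFun Disjoint B)) :
    (poissonLaw μ).map (fun ξ i => (ξ (B i)).toReal) =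
      Measure.pi fun i => (poissonMeasure (μ (B i)).toNNReal).map (Nat.cast : ℕ → ℝ) := by
  have hX : Measurable fun (ξ : Measure E) i => (ξ (B i)).toReal :=
    measurable_pi_lambda _ fun i => (Measure.measurable_coe (hB i)).ennreal_toReal
  have := Measure.isProbabilityMeasure_map (μ := poissonLaw μ) hX.aemeasurable
  have hP : ∀ r, IsProbabilityMeasure ((poissonMeasure r).map (Nat.cast : ℕ → ℝ)) := fun r =>
    Measure.isProbabilityMeasure_map Measurable.of_discrete.aemeasurable
  rw [← charFun_eq_pi_iff]
  intro t
  simp only [charFun_map_cast_poissonMeasure]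
  rw [charFun_apply, integral_map (by fun_prop) (by fun_prop), integral_map hX.aemeasurable
    (by fun_prop)]
  set g : Measure E → ℂ := fun ξ =>
    Complex.exp ((∑ i, ((ξ (B i)).toReal * t i : ℂ)) * Complex.I) with hg
  have hgm : Measurable g := by
    have : ∀ i, Measurable fun ξ : Measure E => (ξ (B i)).toReal := fun i =>
      (Measure.measurable_coe (hB i)).ennreal_toReal
    unfold g
    fun_prop
  have hgi : Integrable g (poissonLaw μ) := by
    refine Integrable.of_bound hgm.aestronglyMeasurable 1 (Filter.Eventually.of_forall fun ξ => ?_)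
    have : (∑ i, ((ξ (B i)).toReal * t i : ℂ)) = ((∑ i, (ξ (B i)).toReal * t i : ℝ) : ℂ) := by
      push_cast; rfl
    simp only [g, this, Complex.norm_exp_ofReal_mul_I, le_refl]
  have hinner : ∀ ξ : Measure E, Complex.exp (inner ℝ (WithLp.toLp 2 fun i => (ξ (B i)).toReal) t *
      Complex.I) = g ξ := by
    intro ξ
    simp [g, PiLp.inner_apply, mul_comm]
  have hconfig : ∀ (n : ℕ) (z : Fin n → E), g (config z) =
      ∏ r, Complex.exp ((∑ i, (B i).indicator (fun _ => (t i : ℂ)) (z r)) * Complex.I) := by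
    intro n z
    rw [← Complex.exp_sum, ← Finset.sum_mul, Finset.sum_comm]
    simp only [g]
    congr 2
    refine Finset.sum_congr rfl fun i _ => ?_
    rw [config_apply z (hB i), ENNReal.toReal_sum, Complex.ofReal_sum, Finset.sum_mul]
    · refine Finset.sum_congr rfl fun r _ => ?_
      by_cases h : z r ∈ B i <;> simp [h]
    · intro r _
      by_cases h : z r ∈ B i <;> simp [h]
  simp only [hinner]
  rw [integral_poissonLaw μ hgi hgm]
  simp only [hconfig]
  have hpow : ∀ n : ℕ, ∫ z : Fin n → E,
      ∏ r, Complex.exp ((∑ i, (B i).indicator (fun _ => (t i : ℂ)) (z r)) * Complex.I)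
        ∂(Measure.pi fun _ : Fin n => μ) =
      (μ.real Set.univ + ∑ i, μ.real (B i) * (Complex.exp (t i * Complex.I) - 1)) ^ n := by
    intro n
    rw [← integral_exp_sum_indicator μ B hB hd t]
    have := integral_fintype_prod_eq_pow (ι := Fin n) (μ := μ)
      (fun w => Complex.exp ((∑ i, (B i).indicator (fun _ => (t i : ℂ)) w) * Complex.I))
    rw [Fintype.card_fin] at this
    exact this
  simp only [hpow]
  have hsum := (NormedSpace.expSeries_div_hasSum_exp (𝔸 := ℂ)
    (μ.real Set.univ + ∑ i, μ.real (B i) * (Complex.exp (t i * Complex.I) - 1))).tsum_eq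
  simp only [div_eq_inv_mul, ← Complex.exp_eq_exp_ℂ] at hsum
  rw [hsum, Complex.ofReal_exp, ← Complex.exp_add, ← Complex.exp_sum]
  congr 1
  simp only [Measure.real, Complex.ofReal_neg, neg_add_cancel_left]
  rfl

theorem map_counts_poissonLaw (μ : Measure E) [IsFiniteMeasure μ] {k : ℕ}
    (B : Fin k → Set E) (hB : ∀ i, MeasurableSet (B i))
    (hd : Pairwise (Function.onFun Disjoint B)) :
    (poissonLaw μ).map (fun ξ i => ξ (B i)) =
      Measure.pi fun i => (poissonMeasure (μ (B i)).toNNReal).map (Nat.cast : ℕ → ℝ≥0∞) := by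
  have hX : Measurable fun (ξ : Measure E) i => (ξ (B i)).toReal :=
    measurable_pi_lambda _ fun i => (Measure.measurable_coe (hB i)).ennreal_toReal
  have hP : ∀ r, IsProbabilityMeasure ((poissonMeasure r).map (Nat.cast : ℕ → ℝ)) := fun r =>
    Measure.isProbabilityMeasure_map Measurable.of_discrete.aemeasurable
  have hO : Measurable fun (v : Fin k → ℝ) i => ENNReal.ofReal (v i) := by fun_prop
  have h1 : (poissonLaw μ).map (fun ξ i => ξ (B i)) =
      ((poissonLaw μ).map (fun ξ i => (ξ (B i)).toReal)).map fun v i => ENNReal.ofReal (v i) := by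
    rw [Measure.map_map hO hX]
    refine Measure.map_congr ?_
    filter_upwards [ae_poissonLaw_univ_lt_top μ] with ξ hξ
    funext i
    exact (ENNReal.ofReal_toReal ((measure_mono (Set.subset_univ _)).trans_lt hξ).ne).symm
  have h2 : ∀ r, ((poissonMeasure r).map (Nat.cast : ℕ → ℝ)).map ENNReal.ofReal =
      (poissonMeasure r).map (Nat.cast : ℕ → ℝ≥0∞) := by
    intro r
    rw [Measure.map_map ENNReal.measurable_ofReal Measurable.of_discrete]
    congr 1
    funext n
    simp
  have hP' : ∀ r, SigmaFinite (((poissonMeasure r).map (Nat.cast : ℕ → ℝ)).map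
      ENNReal.ofReal) := fun r => by
    have := Measure.isProbabilityMeasure_map (μ := (poissonMeasure r).map (Nat.cast : ℕ → ℝ))
      ENNReal.measurable_ofReal.aemeasurable
    infer_instance
  rw [h1, map_toReal_counts_poissonLaw μ B hB hd,
    Measure.pi_map_pi fun i => ENNReal.measurable_ofReal.aemeasurable]
  simp only [h2]

theorem map_eq_poissonLaw {Ω : Type*} [MeasurableSpace Ω] {P : Measure Ω}
    [IsProbabilityMeasure P] {μ : Measure E} [IsFiniteMeasure μ] {Ξc : Ω → Measure E}
    (h : IsPoissonProcess P μ Ξc) : P.map Ξc = poissonLaw μ := by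
  obtain ⟨⟨hm, -⟩, hcount, hindep⟩ := h
  have := Measure.isProbabilityMeasure_map (μ := P) hm.aemeasurable
  refine measure_ext_of_map_counts fun k B hB hd => ?_
  rw [map_counts_poissonLaw μ B hB hd, Measure.map_map (measurable_counts hB) hm]
  have hi := (iIndepFun_iff_map_fun_eq_pi_map (f := fun i ω => Ξc ω (B i)) fun i =>
    ((Measure.measurable_coe (hB i)).comp hm).aemeasurable).1 (hindep k B hB hd)
  simp only [hcount _ (hB _)] at hi
  exact hi

end Poisson

section Pi

theorem lintegral_pi_insertNth {α : Type*} [MeasurableSpace α] {n : ℕ}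
    (μ : Fin (n + 1) → Measure α) [∀ i, SigmaFinite (μ i)] (k : Fin (n + 1))
    {f : (Fin (n + 1) → α) → ℝ≥0∞} (hf : Measurable f) :
    ∫⁻ x, f x ∂(Measure.pi μ) =
      ∫⁻ w, ∫⁻ z, f (k.insertNth (α := fun _ => α) w z)
        ∂(Measure.pi fun i => μ (k.succAbove i)) ∂(μ k) := by
  have h := (measurePreserving_piFinSuccAbove μ k).symm
  rw [← h.lintegral_comp hf]
  exact lintegral_prod _ (hf.comp h.measurable).aemeasurable

theorem measurable_insertNth {α : Type*} [MeasurableSpace α] {n : ℕ} (k : Fin (n + 1)) :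
    Measurable fun y : α × (Fin n → α) => k.insertNth (α := fun _ => α) y.1 y.2 :=
  (MeasurableEquiv.piFinSuccAbove (fun _ => α) k).symm.measurable

theorem lintegral_pi_withDensity {α : Type*} [MeasurableSpace α] {ν : Measure α} [SigmaFinite ν]
    {f : α → ℝ≥0∞} (hf : Measurable f) [SigmaFinite (ν.withDensity f)] {n : ℕ}
    {G : (Fin n → α) → ℝ≥0∞} (hG : Measurable G) :
    ∫⁻ z, G z ∂(Measure.pi fun _ : Fin n => ν.withDensity f) =
      ∫⁻ z, G z * ∏ i, f (z i) ∂(Measure.pi fun _ : Fin n => ν) := by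
  induction n with
  | zero =>
    rw [Measure.pi_of_empty, Measure.pi_of_empty]
    simp
  | succ n ih =>
    have hins := measurable_insertNth (α := α) (0 : Fin (n + 1))
    have hfm : Measurable fun z : Fin n → α => ∏ i, f (z i) := by fun_prop
    have hGw : ∀ w, Measurable fun z => G ((0 : Fin (n + 1)).insertNth (α := fun _ => α) w z) :=
      fun w => (hG.comp hins).comp measurable_prodMk_left
    have hGf : Measurable fun z => G z * ∏ i, f (z i) := by fun_prop
    rw [lintegral_pi_insertNth _ 0 hG, lintegral_pi_insertNth _ 0 hGf]
    simp only [ih (hGw _)]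
    rw [lintegral_withDensity_eq_lintegral_mul _ hf]
    · refine lintegral_congr fun w => ?_
      have hGfw := (hGw w).mul hfm
      simp only [Pi.mul_def] at hGfw
      rw [Pi.mul_apply, ← lintegral_const_mul _ hGfw]
      refine lintegral_congr fun z => ?_
      simp only [Fin.prod_univ_succAbove _ (0 : Fin (n + 1)), Fin.insertNth_apply_same,
        Fin.insertNth_apply_succAbove]
      ring
    · exact Measurable.lintegral_prod_right'
        (f := fun y : α × (Fin n → α) =>
          G ((0 : Fin (n + 1)).insertNth (α := fun _ => α) y.1 y.2) * ∏ i, f (y.2 i))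
        ((hG.comp hins).mul (hfm.comp measurable_snd))

end Pi

section JanossyExpectation

variable {E : Type*} [MeasurableSpace E] {ν : Measure E}

theorem janossyExpectation_congr {j j' : ∀ n : ℕ, (Fin n → E) → ℝ≥0∞} {F : Measure E → ℝ≥0∞}
    (h : ∀ n x, j n x = j' n x) : janossyExpectation ν j F = janossyExpectation ν j' F := by
  simp only [janossyExpectation, h]

theorem janossyExpectation_add {j j' : ∀ n : ℕ, (Fin n → E) → ℝ≥0∞} {F : Measure E → ℝ≥0∞}
    (hj : ∀ n, Measurable (j n)) (hF : Measurable F) :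
    janossyExpectation ν (fun n x => j n x + j' n x) F =
      janossyExpectation ν j F + janossyExpectation ν j' F := by
  simp only [janossyExpectation]
  rw [← ENNReal.tsum_add]
  refine tsum_congr fun n => ?_
  have hm : Measurable fun x => F (config x) * j n x :=
    (hF.comp measurable_config).mul (hj n)
  rw [← mul_add, ← lintegral_add_left hm]
  simp only [mul_add]

theorem janossyExpectation_const_mul {j : ∀ n : ℕ, (Fin n → E) → ℝ≥0∞} {F : Measure E → ℝ≥0∞}
    (c : ℝ≥0∞) (hj : ∀ n, Measurable (j n)) (hF : Measurable F) :
    janossyExpectation ν (fun n x => c * j n x) F = c * janossyExpectation ν j F := by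
  simp only [janossyExpectation]
  rw [← ENNReal.tsum_mul_left]
  refine tsum_congr fun n => ?_
  have hm : Measurable fun x => F (config x) * j n x :=
    (hF.comp measurable_config).mul (hj n)
  rw [mul_left_comm, ← lintegral_const_mul _ hm]
  simp only [mul_left_comm]

/-- The Janossy densities after adding a random point with density `a`. -/
def insertJanossy (a : E → ℝ≥0∞) (K : ∀ m : ℕ, (Fin m → E) → ℝ≥0∞) :
    ∀ m : ℕ, (Fin m → E) → ℝ≥0∞
  | 0, _ => 0
  | m + 1, z => ∑ k, a (z k) * K m fun i => z (k.succAbove i)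

theorem janossyExpectation_insertJanossy [SigmaFinite ν] {a : E → ℝ≥0∞} (ha : Measurable a)
    {K : ∀ m : ℕ, (Fin m → E) → ℝ≥0∞} (hK : ∀ m, Measurable (K m)) {F : Measure E → ℝ≥0∞}
    (hF : Measurable F) :
    janossyExpectation ν (insertJanossy a K) F =
      ∫⁻ w, a w * janossyExpectation ν K (fun ξ => F (Measure.dirac w + ξ)) ∂ν := by
  have hFm : ∀ m, Measurable fun y : E × (Fin m → E) =>
      F (Measure.dirac y.1 + config y.2) * K m y.2 := fun m =>
    (hF.comp ((Measure.measurable_dirac.comp measurable_fst).add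
      (measurable_config.comp measurable_snd))).mul ((hK m).comp measurable_snd)
  have hI : ∀ m, Measurable fun w => ∫⁻ z : Fin m → E, F (Measure.dirac w + config z) * K m z
      ∂(Measure.pi fun _ : Fin m => ν) := fun m => (hFm m).lintegral_prod_right'
  simp only [janossyExpectation]
  rw [tsum_eq_zero_add' ENNReal.summable]
  simp only [insertJanossy, mul_zero, lintegral_zero, zero_add]
  simp only [← ENNReal.tsum_mul_left]
  have hT : ∀ m, Measurable fun w => a w * (((m ! : ℕ) : ℝ≥0∞)⁻¹ * ∫⁻ z : Fin m → E,
      F (Measure.dirac w + config z) * K m z ∂(Measure.pi fun _ : Fin m => ν)) := fun m =>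
    ha.mul ((hI m).const_mul _)
  rw [lintegral_tsum fun m => (hT m).aemeasurable]
  refine tsum_congr fun m => ?_
  have haI : Measurable fun w => a w * ∫⁻ z : Fin m → E,
      F (Measure.dirac w + config z) * K m z ∂(Measure.pi fun _ : Fin m => ν) := ha.mul (hI m)
  have hk : ∀ k : Fin (m + 1), ∫⁻ z : Fin (m + 1) → E,
      F (config z) * (a (z k) * K m fun i => z (k.succAbove i)) ∂(Measure.pi fun _ => ν) =
      ∫⁻ w, a w * ∫⁻ z : Fin m → E, F (Measure.dirac w + config z) * K m z
        ∂(Measure.pi fun _ : Fin m => ν) ∂ν := by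
    intro k
    rw [lintegral_pi_insertNth (fun _ => ν) k]
    · refine lintegral_congr fun w => ?_
      have hFw : Measurable fun z : Fin m → E => F (Measure.dirac w + config z) * K m z :=
        Measurable.comp
          (g := fun y : E × (Fin m → E) => F (Measure.dirac y.1 + config y.2) * K m y.2)
          (f := Prod.mk w) (hFm m) measurable_prodMk_left
      rw [← lintegral_const_mul _ hFw]
      refine lintegral_congr fun z => ?_
      simp only [config_insertNth, Fin.insertNth_apply_same, Fin.insertNth_apply_succAbove]
      ring
    · exact (hF.comp measurable_config).mul
        ((ha.comp (measurable_pi_apply k)).mul ((hK m).comp (by fun_prop)))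
  simp only [Finset.mul_sum]
  rw [lintegral_finsetSum]
  · simp only [hk, Finset.sum_const, Finset.card_univ, Fintype.card_fin, nsmul_eq_mul]
    simp only [mul_left_comm (a _)]
    rw [lintegral_const_mul _ haI, ← mul_assoc]
    congr 1
    rw [Nat.factorial_succ, Nat.cast_mul, ENNReal.mul_inv (by simp) (by simp), mul_right_comm,
      ENNReal.inv_mul_cancel (by simp) (by simp), one_mul]
  · intro k _
    exact (hF.comp measurable_config).mul
        ((ha.comp (measurable_pi_apply k)).mul ((hK m).comp (by fun_prop)))

end JanossyExpectation

section Measurement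

variable {E : Type*} [MeasurableSpace E] {ν : Measure E} {p : ℝ≥0∞} {l : E → E → ℝ≥0∞}
  {lc : E → ℝ≥0∞}

/-- The Janossy densities of the measurements generated by targets at `x` and the clutter. -/
def measurementKernel (ν : Measure E) (p : ℝ≥0∞) (l : E → E → ℝ≥0∞) (lc : E → ℝ≥0∞) {n : ℕ}
    (x : Fin n → E) (m : ℕ) (z : Fin m → E) : ℝ≥0∞ :=
  noClutter ν lc * assignmentSum (1 - p) (fun k => lc (z k)) fun k a => p * l (z k) (x a)

theorem jointJanossy_eq (j : ∀ n : ℕ, (Fin n → E) → ℝ≥0∞) (n m : ℕ) (x : Fin n → E)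
    (z : Fin m → E) :
    jointJanossy ν p l lc j n m x z = j n x * measurementKernel ν p l lc x m z := by
  rw [jointJanossy, measurementKernel, ← sum_subset_embedding_eq_assignmentSum]

theorem measurable_measurementKernel (hl : Measurable (Function.uncurry l)) (hlc : Measurable lc)
    (n m : ℕ) : Measurable fun y : (Fin n → E) × (Fin m → E) =>
      measurementKernel ν p l lc y.1 m y.2 := by
  classical
  unfold measurementKernel assignmentSum assignmentWeight
  refine Measurable.const_mul (Finset.measurable_fun_sum _ fun f _ => ?_) _
  split_ifs
  · refine Measurable.const_mul (Finset.measurable_fun_prod _ fun k _ => ?_) _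
    cases f k with
    | none => exact hlc.comp ((measurable_pi_apply k).comp measurable_snd)
    | some a =>
      have hza : Measurable fun y : (Fin n → E) × (Fin m → E) => (y.2 k, y.1 a) := by fun_prop
      exact (hl.comp hza).const_mul p
  · exact measurable_const

theorem measurable_measurementKernel_right (hl : Measurable (Function.uncurry l))
    (hlc : Measurable lc) {n : ℕ} (x : Fin n → E) (m : ℕ) :
    Measurable (measurementKernel ν p l lc x m) :=
  Measurable.comp (g := fun y : (Fin n → E) × (Fin m → E) => measurementKernel ν p l lc y.1 m y.2)
    (f := Prod.mk x) (measurable_measurementKernel hl hlc n m) measurable_prodMk_left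

theorem measurementKernel_comp_perm {n m : ℕ} (x : Fin n → E) (z : Fin m → E)
    (σ : Equiv.Perm (Fin n)) (τ : Equiv.Perm (Fin m)) :
    measurementKernel ν p l lc (x ∘ σ) m (z ∘ τ) = measurementKernel ν p l lc x m z := by
  unfold measurementKernel
  congr 1
  exact assignmentSum_comp_perm (1 - p) (fun k => lc (z k)) (fun k a => p * l (z k) (x a)) τ σ

theorem measurementKernel_succ {n : ℕ} (x : Fin (n + 1) → E) (m : ℕ) (z : Fin m → E) :
    measurementKernel ν p l lc x m z =
      (1 - p) * measurementKernel ν p l lc (fun i => x i.succ) m z +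
        insertJanossy (fun w => p * l w (x 0)) (measurementKernel ν p l lc fun i => x i.succ)
          m z := by
  cases m with
  | zero =>
    simp only [measurementKernel, insertJanossy, add_zero]
    rw [assignmentSum_succ_of_isEmpty]
    ring
  | succ m =>
    simp only [measurementKernel, insertJanossy]
    rw [assignmentSum_succ, mul_add, mul_left_comm, Finset.mul_sum]
    simp only [mul_left_comm (noClutter ν lc)]

theorem isProbabilityMeasure_detectionLaw (hp : p ≤ 1) (hl1 : ∀ x, ∫⁻ z, l z x ∂ν = 1) (x : E) :
    IsProbabilityMeasure (detectionLaw ν p l x) := by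
  constructor
  have h : ((ν.withDensity fun z => l z x).map Measure.dirac) Set.univ = 1 := by
    rw [Measure.map_apply Measure.measurable_dirac MeasurableSet.univ, Set.preimage_univ,
      withDensity_apply _ MeasurableSet.univ, Measure.restrict_univ, hl1]
  simp [detectionLaw, h, tsub_add_cancel_of_le hp]

theorem lintegral_detectionLaw (hl : Measurable (Function.uncurry l)) (x : E)
    {G : Measure E → ℝ≥0∞} (hG : Measurable G) :
    ∫⁻ η, G η ∂(detectionLaw ν p l x) =
      (1 - p) * G 0 + ∫⁻ w, p * l w x * G (Measure.dirac w) ∂ν := by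
  have hlx : Measurable fun w => l w x := hl.comp measurable_prodMk_right
  have hGd : Measurable fun w : E => G (Measure.dirac w) := hG.comp Measure.measurable_dirac
  rw [detectionLaw, lintegral_add_measure, lintegral_smul_measure, lintegral_smul_measure,
    lintegral_dirac' _ hG, lintegral_map hG Measure.measurable_dirac,
    lintegral_withDensity_eq_lintegral_mul _ hlx hGd]
  simp only [smul_eq_mul, mul_assoc, Pi.mul_apply]
  have hlG : Measurable fun w => l w x * G (Measure.dirac w) := hlx.mul hGd
  rw [lintegral_const_mul _ hlG]

theorem measurable_finSum {n : ℕ} : Measurable fun η : Fin n → Measure E => ∑ i, η i :=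
  Finset.measurable_fun_sum _ fun i _ => measurable_pi_apply i

theorem thinnedShiftedLaw_zero (x : Fin 0 → E) :
    thinnedShiftedLaw ν p l x = Measure.dirac 0 := by
  rw [thinnedShiftedLaw, Measure.pi_of_empty, Measure.map_dirac' measurable_finSum]
  simp

theorem lintegral_thinnedShiftedLaw_succ (hp : p ≤ 1) (hl : Measurable (Function.uncurry l))
    (hl1 : ∀ x, ∫⁻ z, l z x ∂ν = 1) {n : ℕ} (x : Fin (n + 1) → E) {G : Measure E → ℝ≥0∞}
    (hG : Measurable G) :
    ∫⁻ η, G η ∂(thinnedShiftedLaw ν p l x) =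
      (1 - p) * ∫⁻ η, G η ∂(thinnedShiftedLaw ν p l fun i => x i.succ) +
        ∫⁻ w, p * l w (x 0) *
          ∫⁻ η, G (Measure.dirac w + η) ∂(thinnedShiftedLaw ν p l fun i => x i.succ) ∂ν := by
  have hprob := fun y => isProbabilityMeasure_detectionLaw (p := p) hp hl1 y
  have hGadd : ∀ ξ : Measure E, Measurable fun η => G (ξ + η) := fun ξ =>
    hG.comp (measurable_const.add measurable_id)
  have hGsum : Measurable fun η : Fin (n + 1) → Measure E => G (∑ i, η i) :=
    hG.comp measurable_finSum
  simp only [thinnedShiftedLaw]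
  rw [lintegral_map hG measurable_finSum, lintegral_map hG measurable_finSum,
    lintegral_pi_insertNth _ 0 hGsum]
  simp only [lintegral_map (hGadd _) measurable_finSum,
    Fin.sum_univ_succAbove _ (0 : Fin (n + 1)), Fin.insertNth_apply_same,
    Fin.insertNth_apply_succAbove]
  simp only [Fin.succAbove_zero]
  rw [lintegral_detectionLaw hl]
  · simp only [zero_add]
  · refine Measurable.lintegral_prod_right'
      (f := fun y : Measure E × (Fin n → Measure E) => G (y.1 + ∑ i, y.2 i)) ?_
    exact hG.comp (measurable_fst.add (measurable_finSum.comp measurable_snd))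

theorem lintegral_thinnedShiftedLaw_poissonLaw [SigmaFinite ν] (hp : p ≤ 1)
    (hl : Measurable (Function.uncurry l)) (hl1 : ∀ x, ∫⁻ z, l z x ∂ν = 1) (hlc : Measurable lc)
    (hlc_fin : ∫⁻ z, lc z ∂ν ≠ ∞) {n : ℕ} (x : Fin n → E) {F : Measure E → ℝ≥0∞}
    (hF : Measurable F) :
    ∫⁻ η, ∫⁻ ζ, F (η + ζ) ∂(poissonLaw (ν.withDensity lc)) ∂(thinnedShiftedLaw ν p l x) =
      janossyExpectation ν (measurementKernel ν p l lc x) F := by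
  have hfin : IsFiniteMeasure (ν.withDensity lc) := isFiniteMeasure_withDensity hlc_fin
  induction n generalizing F with
  | zero =>
    have hFm : Measurable fun η => ∫⁻ ζ, F (η + ζ) ∂(poissonLaw (ν.withDensity lc)) :=
      Measurable.lintegral_prod_right' (f := fun y : Measure E × Measure E => F (y.1 + y.2))
        (hF.comp measurable_add)
    rw [thinnedShiftedLaw_zero, lintegral_dirac' _ hFm]
    simp only [zero_add]
    rw [lintegral_poissonLaw _ hF, janossyExpectation, ← ENNReal.tsum_mul_left]
    refine tsum_congr fun m => ?_
    have hprod : Measurable fun z : Fin m → E => ∏ i, lc (z i) := by fun_prop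
    have hFc : Measurable fun z : Fin m → E => F (config z) := hF.comp measurable_config
    have hFp : Measurable fun z : Fin m → E => F (config z) * ∏ i, lc (z i) := hFc.mul hprod
    rw [lintegral_pi_withDensity hlc hFc, mul_left_comm, ← lintegral_const_mul _ hFp]
    congr 1
    refine lintegral_congr fun z => ?_
    rw [measurementKernel, assignmentSum_zero, noClutter, withDensity_apply _ MeasurableSet.univ,
      Measure.restrict_univ, mul_left_comm]
  | succ n ih =>
    have hKm : ∀ m, Measurable (measurementKernel ν p l lc (fun i => x i.succ) m) := fun m =>
      measurable_measurementKernel_right hl hlc _ m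
    have hlx : Measurable fun w => p * l w (x 0) :=
      (hl.comp measurable_prodMk_right).const_mul p
    have hFm : Measurable fun η => ∫⁻ ζ, F (η + ζ) ∂(poissonLaw (ν.withDensity lc)) :=
      Measurable.lintegral_prod_right' (f := fun y : Measure E × Measure E => F (y.1 + y.2))
        (hF.comp measurable_add)
    rw [lintegral_thinnedShiftedLaw_succ hp hl hl1 x hFm, ih _ hF,
      janossyExpectation_congr (measurementKernel_succ x),
      janossyExpectation_add (fun m => (hKm m).const_mul _) hF,
      janossyExpectation_const_mul _ hKm hF, janossyExpectation_insertJanossy hlx hKm hF]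
    congr 1
    refine lintegral_congr fun w => ?_
    simp only [add_assoc]
    rw [ih _ (F := fun ξ => F (Measure.dirac w + ξ))
      (hF.comp (measurable_const.add measurable_id))]

variable {Ω : Type*} [MeasurableSpace Ω] {P : Measure Ω}
  {Φ Ξ : Ω → Measure E} {j : ∀ n : ℕ, (Fin n → E) → ℝ≥0∞}

theorem measurable_of_isMeasurementProcess (h : IsMeasurementProcess P ν p l lc Φ Ξ) :
    Measurable Ξ := by
  obtain ⟨Ξs, Ξc, ⟨⟨hsm, -⟩, -⟩, ⟨⟨hcm, -⟩, -, -⟩, -, hΞ⟩ := h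
  rw [funext hΞ]
  exact hsm.add hcm

theorem lintegral_of_isMeasurementProcess [IsProbabilityMeasure P] [SigmaFinite ν] (hp : p ≤ 1)
    (hl : Measurable (Function.uncurry l)) (hl1 : ∀ x, ∫⁻ z, l z x ∂ν = 1) (hlc : Measurable lc)
    (hlc_fin : ∫⁻ z, lc z ∂ν ≠ ∞) (hΦ : Measurable Φ) (hj : HasJanossyDensities P ν Φ j)
    (hΞ : IsMeasurementProcess P ν p l lc Φ Ξ) {F : Measure E × Measure E → ℝ≥0∞}
    (hF : Measurable F) :
    ∫⁻ ω, F (Φ ω, Ξ ω) ∂P =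
      ∑' n : ℕ, ∑' m : ℕ, (((n ! : ℕ) : ℝ≥0∞) * ((m ! : ℕ) : ℝ≥0∞))⁻¹ *
        ∫⁻ x : Fin n → E, ∫⁻ z : Fin m → E, F (config x, config z) * jointJanossy ν p l lc j n m x z
          ∂(Measure.pi fun _ : Fin m => ν) ∂(Measure.pi fun _ : Fin n => ν) := by
  have hfin : IsFiniteMeasure (ν.withDensity lc) := isFiniteMeasure_withDensity hlc_fin
  obtain ⟨Ξs, Ξc, ⟨⟨hsm, -⟩, κ, hκ, hκx, hκP⟩, hc, hind, hΞ⟩ := hΞ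
  have hcm : Measurable Ξc := hc.1.1
  have hpair : Measurable fun ω => (Φ ω, Ξs ω) := hΦ.prodMk hsm
  have := Measure.isProbabilityMeasure_map (μ := P) hΦ.aemeasurable
  have hmap := (indepFun_iff_map_prod_eq_prod_map_map hpair.aemeasurable hcm.aemeasurable).1 hind
  rw [hκP, map_eq_poissonLaw hc] at hmap
  have hF3 : Measurable fun y : (Measure E × Measure E) × Measure E =>
      F (y.1.1, y.1.2 + y.2) :=
    hF.comp ((measurable_fst.comp measurable_fst).prodMk
      ((measurable_snd.comp measurable_fst).add measurable_snd))
  have hF2 : Measurable fun y : Measure E × Measure E =>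
      ∫⁻ ζ, F (y.1, y.2 + ζ) ∂(poissonLaw (ν.withDensity lc)) := hF3.lintegral_prod_right'
  have hH : Measurable fun ξ => ∫⁻ η, ∫⁻ ζ, F (ξ, η + ζ) ∂(poissonLaw (ν.withDensity lc)) ∂(κ ξ) :=
    hF2.lintegral_kernel_prod_right'
  have hJ : ∀ n m, Measurable fun y : (Fin n → E) × (Fin m → E) =>
      F (config y.1, config y.2) * (j n y.1 * measurementKernel ν p l lc y.1 m y.2) := fun n m =>
    (hF.comp ((measurable_config.comp measurable_fst).prodMk
      (measurable_config.comp measurable_snd))).mul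
      (((hj.measurable n).comp measurable_fst).mul (measurable_measurementKernel hl hlc n m))
  simp only [hΞ]
  rw [← lintegral_map (f := fun y : (Measure E × Measure E) × Measure E => F (y.1.1, y.1.2 + y.2))
    (g := fun ω => ((Φ ω, Ξs ω), Ξc ω)) hF3 (hpair.prodMk hcm), hmap,
    lintegral_prod _ hF3.aemeasurable, Measure.lintegral_compProd hF2, lintegral_map hH hΦ,
    hj.expectation _ hH, janossyExpectation]
  refine tsum_congr fun n => ?_
  have hFx : ∀ x : Fin n → E, Measurable fun ξ => F (config x, ξ) := fun x =>
    hF.comp measurable_prodMk_left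
  have hI : ∀ m, Measurable fun x : Fin n → E => ∫⁻ z : Fin m → E,
      F (config x, config z) * (j n x * measurementKernel ν p l lc x m z)
        ∂(Measure.pi fun _ : Fin m => ν) := fun m => (hJ n m).lintegral_prod_right'
  have hx : ∀ x : Fin n → E, (∫⁻ η, ∫⁻ ζ, F (config x, η + ζ) ∂(poissonLaw (ν.withDensity lc))
      ∂(κ (config x))) * j n x = ∑' m : ℕ, ((m ! : ℕ) : ℝ≥0∞)⁻¹ * ∫⁻ z : Fin m → E,
        F (config x, config z) * (j n x * measurementKernel ν p l lc x m z)
          ∂(Measure.pi fun _ : Fin m => ν) := by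
    intro x
    rw [hκx, lintegral_thinnedShiftedLaw_poissonLaw hp hl hl1 hlc hlc_fin x (hFx x),
      janossyExpectation, ← ENNReal.tsum_mul_right]
    refine tsum_congr fun m => ?_
    have hm : Measurable fun z : Fin m → E =>
        F (config x, config z) * measurementKernel ν p l lc x m z :=
      ((hFx x).comp measurable_config).mul
        (measurable_measurementKernel_right hl hlc x m)
    rw [mul_assoc, ← lintegral_mul_const _ hm]
    congr 1
    refine lintegral_congr fun z => ?_
    ring
  simp only [hx, jointJanossy_eq]
  rw [lintegral_tsum fun m => ((hI m).const_mul _).aemeasurable, ← ENNReal.tsum_mul_left]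
  refine tsum_congr fun m => ?_
  rw [lintegral_const_mul _ (hI m), ENNReal.mul_inv (by simp) (by simp), mul_assoc]

end Measurement

section Marginal

variable {E : Type*} [MeasurableSpace E] {ν : Measure E} [SigmaFinite ν]

theorem lintegral_pi_comp_perm {n : ℕ} (σ : Equiv.Perm (Fin n)) (f : (Fin n → E) → ℝ≥0∞) :
    ∫⁻ x, f (x ∘ σ) ∂(Measure.pi fun _ : Fin n => ν) =
      ∫⁻ x, f x ∂(Measure.pi fun _ : Fin n => ν) := by
  have h := measurePreserving_piCongrLeft (fun _ : Fin n => ν) σ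
  rw [← h.lintegral_comp_emb (MeasurableEquiv.measurableEmbedding _)]
  refine lintegral_congr fun x => congrArg f (funext fun i => ?_)
  exact Equiv.piCongrLeft_apply_apply (fun _ : Fin n => E) σ x i

theorem lintegral_symmetric_mul_prod_embedding {n m : ℕ} {f : (Fin n → E) → ℝ≥0∞}
    (hf : ∀ (σ : Equiv.Perm (Fin n)) x, f (x ∘ σ) = f x) (v : Fin m → E → ℝ≥0∞)
    (S : Finset (Fin m)) (hS : S.card ≤ n) (π : S ↪ Fin n) :
    ∫⁻ x, f x * ∏ i : S, v i (x (π i)) ∂(Measure.pi fun _ : Fin n => ν) =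
      ∫⁻ x, f x * ∏ k : Fin S.card, v (S.orderEmbOfFin rfl k) (x (Fin.castLE hS k))
        ∂(Measure.pi fun _ : Fin n => ν) := by
  obtain ⟨σ, hσ⟩ := Equiv.Perm.exists_extending_pair (Fin.castLE hS)
    (fun k => π (S.orderIsoOfFin rfl k)) (Fin.castLE_injective hS)
    (π.injective.comp (S.orderIsoOfFin rfl).injective)
  refine Eq.trans (lintegral_congr fun x => ?_) (lintegral_pi_comp_perm σ _)
  rw [hf]
  congr 1
  rw [← Equiv.prod_comp (S.orderIsoOfFin rfl).toEquiv]
  refine Finset.prod_congr rfl fun k _ => ?_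
  rw [Function.comp_apply, hσ]
  rfl

theorem inv_factorial_mul_descFactorial {n k : ℕ} (h : k ≤ n) :
    ((n ! : ℕ) : ℝ≥0∞)⁻¹ * (n.descFactorial k : ℕ) = (((n - k)! : ℕ) : ℝ≥0∞)⁻¹ := by
  rw [← Nat.factorial_mul_descFactorial h, Nat.cast_mul, ENNReal.mul_inv (by simp) (by simp),
    mul_assoc, ENNReal.inv_mul_cancel _ (ENNReal.natCast_ne_top _), mul_one]
  exact_mod_cast (Nat.descFactorial_pos.2 h).ne'

/-- The density of the measurements is the marginal of the joint density. -/
theorem measurementJanossy_eq_janossyExpectation {p : ℝ≥0∞} {l : E → E → ℝ≥0∞} {lc : E → ℝ≥0∞}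
    (hl : Measurable (Function.uncurry l)) {j : ∀ n : ℕ, (Fin n → E) → ℝ≥0∞}
    (hj : ∀ n, Measurable (j n))
    (hsymm : ∀ (n : ℕ) (σ : Equiv.Perm (Fin n)) (x : Fin n → E), j n (x ∘ σ) = j n x)
    (m : ℕ) (z : Fin m → E) :
    measurementJanossy ν p l lc j m z =
      janossyExpectation ν (fun n x => jointJanossy ν p l lc j n m x z) fun _ => 1 := by
  rw [measurementJanossy, janossyExpectation, ← ENNReal.tsum_mul_left]
  refine tsum_congr fun n => ?_
  have hterm : ∀ (S : Finset (Fin m)) (π : S ↪ Fin n), Measurable fun x : Fin n → E =>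
      j n x * ∏ i : S, p * l (z i) (x (π i)) := by
    intro S π
    refine (hj n).mul (Finset.measurable_fun_prod _ fun i _ => Measurable.const_mul ?_ p)
    have : Measurable fun x : Fin n → E => (z i, x (π i)) := by fun_prop
    exact hl.comp this
  have hexp : ∀ x : Fin n → E, 1 * jointJanossy ν p l lc j n m x z =
      ∑ S : {S : Finset (Fin m) // S.card ≤ n}, ∑ π : S.1 ↪ Fin n,
        noClutter ν lc * ((1 - p) ^ (n - S.1.card) * ∏ k ∈ S.1ᶜ, lc (z k)) *
          (j n x * ∏ i : S.1, p * l (z i) (x (π i))) := by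
    intro x
    rw [jointJanossy, one_mul, Finset.mul_sum, Finset.mul_sum]
    refine Finset.sum_congr rfl fun S _ => ?_
    simp only [Finset.mul_sum]
    refine Finset.sum_congr rfl fun π _ => ?_
    ring
  simp only [hexp]
  rw [lintegral_finsetSum _ fun S _ => Finset.measurable_fun_sum _ fun π _ =>
    (hterm S.1 π).const_mul _, Finset.mul_sum, Finset.mul_sum]
  refine Finset.sum_congr rfl fun S _ => ?_
  rw [lintegral_finsetSum _ fun π _ => (hterm S.1 π).const_mul _]
  simp only [lintegral_const_mul _ (hterm S.1 _),
    lintegral_symmetric_mul_prod_embedding (hsymm n) (fun k y => p * l (z k) y) S.1 S.2,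
    Finset.sum_const, Finset.card_univ, Fintype.card_embedding_eq, Fintype.card_coe,
    Fintype.card_fin, nsmul_eq_mul]
  rw [ENNReal.div_eq_inv_mul, ← inv_factorial_mul_descFactorial S.2]
  ring

end Marginal

section Factorization

variable {E : Type*} [MeasurableSpace E]

theorem exists_perm_of_config_eq [MeasurableSingletonClass E] {m : ℕ} {y z : Fin m → E}
    (h : config y = config z) : ∃ σ : Equiv.Perm (Fin m), z = y ∘ σ := by
  classical
  have hcard : ∀ (x : Fin m → E) (a : E),
      config x {a} = (Fintype.card {i // x i = a} : ℕ) := by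
    intro x a
    rw [config_apply x (measurableSet_singleton a), Fintype.card_subtype]
    simp [Set.indicator_apply]
  have hfib : ∀ a, Nonempty ({i // z i = a} ≃ {i // y i = a}) := by
    intro a
    refine ⟨Fintype.equivOfCardEq ?_⟩
    have := hcard z a
    rw [← h, hcard y a] at this
    exact_mod_cast this.symm
  exact ⟨Equiv.ofFiberEquiv fun a => (hfib a).some,
    funext fun i => (Equiv.ofFiberEquiv_map (fun a => (hfib a).some) i).symm⟩

theorem isFiniteMeasure_config {m : ℕ} (z : Fin m → E) : IsFiniteMeasure (config z) :=
  ⟨by simp [config_univ]⟩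

/-- Countably many measurable sets which determine finite measures of a given total mass. -/
theorem exists_seq_measurableSet_ext [StandardBorelSpace E] :
    ∃ B : ℚ → Set E, (∀ q, MeasurableSet (B q)) ∧ ∀ μ μ' : Measure E, IsFiniteMeasure μ →
      μ Set.univ = μ' Set.univ → (∀ q, μ (B q) = μ' (B q)) → μ = μ' := by
  obtain ⟨e, he⟩ := MeasureTheory.exists_measurableEmbedding_real E
  refine ⟨fun q => e ⁻¹' Set.Iic (q : ℝ), fun q => he.measurable measurableSet_Iic, ?_⟩
  intro μ μ' hμ huniv hB
  have hgen : (inferInstance : MeasurableSpace E) =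
      MeasurableSpace.generateFrom (Set.preimage e '' ⋃ q : ℚ, {Set.Iic (q : ℝ)}) := by
    rw [← MeasurableSpace.comap_generateFrom, ← Real.borel_eq_generateFrom_Iic_rat,
      ← BorelSpace.measurable_eq, he.comap_eq]
  refine ext_of_generate_finite _ hgen ?_ ?_ huniv
  · have := Real.isPiSystem_Iic_rat.comap e
    convert this using 1
    ext s
    simp [Set.mem_image]
  · rintro _ ⟨s, hs, rfl⟩
    simp only [Set.mem_iUnion, Set.mem_singleton_iff] at hs
    obtain ⟨q, rfl⟩ := hs
    exact hB q

/-- A measurable function on a standard Borel space which factors through a measurable map into a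
countably separated space factors measurably. -/
theorem exists_measurable_factor {X Y : Type*} [MeasurableSpace X] [StandardBorelSpace X]
    [MeasurableSpace Y] [MeasurableSpace.CountablySeparated Y] {f : X → Y} (hf : Measurable f)
    {r : X → ℝ≥0∞} (hr : Measurable r) (hfr : ∀ x y, f x = f y → r x = r y) :
    ∃ h : Y → ℝ≥0∞, Measurable h ∧ ∀ x, h (f x) = r x := by
  have hr' : Measurable[MeasurableSpace.comap f inferInstance] r := by
    intro s hs
    have hpre : f ⁻¹' (f '' (r ⁻¹' s)) = r ⁻¹' s := by
      refine Set.Subset.antisymm ?_ (Set.subset_preimage_image _ _)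
      rintro x ⟨y, hy, hxy⟩
      rwa [Set.mem_preimage, ← hfr y x hxy]
    have hm : MeasurableSet (f ⁻¹' (f '' (r ⁻¹' s))) := by
      rw [hpre]
      exact hr hs
    have hsep : MeasurableSpace.CountablySeparated (Set.range f) :=
      MeasurableSpace.Subtype.countablySeparated
    obtain ⟨t, ht, hteq⟩ := hf.measurableSet_preimage_iff_preimage_val.1 hm
    refine ⟨t, ht, ?_⟩
    rw [← hpre]
    ext x
    exact Set.ext_iff.1 hteq ⟨f x, x, rfl⟩
  obtain ⟨h, hh, hcomp⟩ := hr'.exists_eq_measurable_comp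
  exact ⟨h, hh, fun x => (congrFun hcomp x).symm⟩

/-- A symmetric measurable function of the points is a measurable function of the configuration. -/
theorem exists_measurable_comp_config [StandardBorelSpace E] {r : ∀ m : ℕ, (Fin m → E) → ℝ≥0∞}
    (hr : ∀ m, Measurable (r m))
    (hsymm : ∀ (m : ℕ) (σ : Equiv.Perm (Fin m)) (z : Fin m → E), r m (z ∘ σ) = r m z) :
    ∃ g : Measure E → ℝ≥0∞, Measurable g ∧ ∀ (m : ℕ) (z : Fin m → E), g (config z) = r m z := by
  classical
  obtain ⟨B, hB, hext⟩ := exists_seq_measurableSet_ext (E := E)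
  have hfac : ∀ m, ∃ h : (ℚ → ℝ≥0∞) → ℝ≥0∞, Measurable h ∧
      ∀ z : Fin m → E, h (fun q => config z (B q)) = r m z := by
    intro m
    refine exists_measurable_factor ((measurable_counts hB).comp measurable_config) (hr m) ?_
    intro y z hyz
    have := isFiniteMeasure_config y
    obtain ⟨σ, rfl⟩ := exists_perm_of_config_eq
      (hext (config y) (config z) this (by simp [config_univ]) (congrFun hyz))
    exact (hsymm m σ y).symm
  choose h hh hhr using hfac
  refine ⟨fun ξ => ∑' m : ℕ, if ξ Set.univ = m then h m fun q => ξ (B q) else 0, ?_, ?_⟩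
  · refine Measurable.tsum fun m => Measurable.ite ?_ ?_ measurable_const
    · exact Measure.measurable_coe MeasurableSet.univ (measurableSet_singleton _)
    · exact (hh m).comp (measurable_counts hB)
  · intro m z
    refine (tsum_eq_single m fun m' hm' => ?_).trans ?_
    · rw [if_neg]
      rw [config_univ]
      exact_mod_cast hm'.symm
    · rw [if_pos (config_univ z), hhr]

end Factorization

section Conditional

variable {Ω E : Type*} [MeasurableSpace Ω] [MeasurableSpace E] {P : Measure Ω} {ν : Measure E}
  {Φ Ξ : Ω → Measure E} {J : ∀ n m : ℕ, (Fin n → E) → (Fin m → E) → ℝ≥0∞}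

theorem measurable_janossyExpectation_right [SigmaFinite ν]
    (hJ : ∀ n m, Measurable (Function.uncurry (J n m)))
    {a : Measure E → ℝ≥0∞} (ha : Measurable a) (m : ℕ) :
    Measurable fun z : Fin m → E => janossyExpectation ν (fun n x => J n m x z) a := by
  unfold janossyExpectation
  refine Measurable.tsum fun n => Measurable.const_mul ?_ _
  refine Measurable.lintegral_prod_left'
    (f := fun y : (Fin n → E) × (Fin m → E) => a (config y.1) * J n m y.1 y.2) ?_
  exact ((ha.comp measurable_config).comp measurable_fst).mul (hJ n m)

theorem HasJointJanossyDensities.lintegral_mul_eq [SigmaFinite ν]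
    (h : HasJointJanossyDensities P ν Φ Ξ J)
    {a b : Measure E → ℝ≥0∞} (ha : Measurable a) (hb : Measurable b) :
    ∫⁻ ω, a (Φ ω) * b (Ξ ω) ∂P = ∑' m : ℕ, ((m ! : ℕ) : ℝ≥0∞)⁻¹ * ∫⁻ z : Fin m → E,
      b (config z) * janossyExpectation ν (fun n x => J n m x z) a
        ∂(Measure.pi fun _ : Fin m => ν) := by
  rw [h.expectation (fun y => a y.1 * b y.2)
    ((ha.comp measurable_fst).mul (hb.comp measurable_snd)), ENNReal.tsum_comm]
  refine tsum_congr fun m => ?_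
  have hm : ∀ n, Measurable fun y : (Fin n → E) × (Fin m → E) =>
      a (config y.1) * b (config y.2) * J n m y.1 y.2 := fun n =>
    (((ha.comp measurable_config).comp measurable_fst).mul
      ((hb.comp measurable_config).comp measurable_snd)).mul (h.measurable n m)
  have hI : ∀ n, Measurable fun z : Fin m → E => ∫⁻ x : Fin n → E,
      a (config x) * b (config z) * J n m x z ∂(Measure.pi fun _ : Fin n => ν) := fun n =>
    Measurable.lintegral_prod_left'
      (f := fun y : (Fin n → E) × (Fin m → E) => a (config y.1) * b (config y.2) * J n m y.1 y.2)
      (hm n)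
  have hz : ∀ z : Fin m → E, b (config z) * janossyExpectation ν (fun n x => J n m x z) a =
      ∑' n : ℕ, ((n ! : ℕ) : ℝ≥0∞)⁻¹ * ∫⁻ x : Fin n → E,
        a (config x) * b (config z) * J n m x z ∂(Measure.pi fun _ : Fin n => ν) := by
    intro z
    rw [janossyExpectation, ← ENNReal.tsum_mul_left]
    refine tsum_congr fun n => ?_
    have hx : Measurable fun x : Fin n → E => a (config x) * J n m x z :=
      (ha.comp measurable_config).mul ((h.measurable n m).comp measurable_prodMk_right)
    rw [mul_left_comm, ← lintegral_const_mul _ hx]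
    congr 1
    refine lintegral_congr fun x => ?_
    ring
  simp only [hz]
  rw [lintegral_tsum fun n => ((hI n).const_mul _).aemeasurable, ← ENNReal.tsum_mul_left]
  refine tsum_congr fun n => ?_
  rw [lintegral_const_mul _ (hI n), ← mul_assoc, ENNReal.mul_inv (by simp) (by simp),
    mul_comm ((n ! : ℕ) : ℝ≥0∞)⁻¹, lintegral_lintegral_swap (hm n).aemeasurable]

/-- The marginal of joint Janossy densities is a family of Janossy densities. -/
theorem HasJointJanossyDensities.hasJanossyDensities_snd [SigmaFinite ν]
    (h : HasJointJanossyDensities P ν Φ Ξ J) :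
    HasJanossyDensities P ν Ξ fun m z =>
      janossyExpectation ν (fun n x => J n m x z) fun _ => 1 where
  measurable := measurable_janossyExpectation_right h.measurable measurable_const
  symmetric m τ z := janossyExpectation_congr fun n x => by
    simpa using h.symmetric n m (Equiv.refl _) τ x z
  expectation F hF := by
    simpa [janossyExpectation] using h.lintegral_mul_eq (a := fun _ => 1) measurable_const hF

theorem janossyExpectation_div {j : ∀ n : ℕ, (Fin n → E) → ℝ≥0∞} {F : Measure E → ℝ≥0∞}
    (c : ℝ≥0∞) (hj : ∀ n, Measurable (j n)) (hF : Measurable F) :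
    janossyExpectation ν (fun n x => j n x / c) F = janossyExpectation ν j F / c := by
  simp only [ENNReal.div_eq_inv_mul]
  exact janossyExpectation_const_mul _ hj hF

theorem janossyExpectation_mono {j : ∀ n : ℕ, (Fin n → E) → ℝ≥0∞} {F F' : Measure E → ℝ≥0∞}
    (h : ∀ ξ, F ξ ≤ F' ξ) : janossyExpectation ν j F ≤ janossyExpectation ν j F' := by
  unfold janossyExpectation
  gcongr
  exact h _

/-- Janossy densities of a point process are almost everywhere finite. -/
theorem HasJanossyDensities.ae_ne_top [IsFiniteMeasure P] {D : ∀ m : ℕ, (Fin m → E) → ℝ≥0∞}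
    (h : HasJanossyDensities P ν Ξ D) (m : ℕ) :
    ∀ᵐ z ∂(Measure.pi fun _ : Fin m => ν), D m z ≠ ∞ := by
  have htot : janossyExpectation ν D (fun _ => 1) ≠ ∞ := by
    rw [← h.expectation _ measurable_const]
    simp
  have hm := ENNReal.ne_top_of_tsum_ne_top htot m
  have hI : ∫⁻ z, D m z ∂(Measure.pi fun _ : Fin m => ν) ≠ ∞ := by
    intro htop
    refine hm ?_
    simp only [one_mul, htop]
    exact ENNReal.mul_top (by simp)
  filter_upwards [ae_lt_top (h.measurable m) hI] with z hz using hz.ne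

/-- Conditional Janossy densities are quotients of joint and marginal Janossy densities. -/
theorem HasJointJanossyDensities.hasCondJanossyDensities [StandardBorelSpace E]
    [SigmaFinite ν] [IsProbabilityMeasure P] (h : HasJointJanossyDensities P ν Φ Ξ J)
    (hΦ : Measurable Φ) (hΞ : Measurable Ξ) :
    HasCondJanossyDensities P ν Φ Ξ fun n m x z =>
      J n m x z / janossyExpectation ν (fun n x => J n m x z) fun _ => 1 := by
  set D : ∀ m : ℕ, (Fin m → E) → ℝ≥0∞ := fun m z =>
    janossyExpectation ν (fun n x => J n m x z) fun _ => 1 with hDdef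
  have hD : HasJanossyDensities P ν Ξ D := h.hasJanossyDensities_snd
  have hmeas : ∀ n m, Measurable (Function.uncurry fun (x : Fin n → E) (z : Fin m → E) =>
      J n m x z / D m z) := fun n m =>
    (h.measurable n m).div ((hD.measurable m).comp measurable_snd)
  refine ⟨hmeas, fun n m σ x z => ?_, fun A hA => ?_⟩
  · have := h.symmetric n m σ (Equiv.refl _) x z
    simp only [Equiv.coe_refl, Function.comp_id] at this
    rw [this]
  have hind : Measurable (A.indicator fun _ => (1 : ℝ≥0∞)) := measurable_const.indicator hA
  set N : ∀ m : ℕ, (Fin m → E) → ℝ≥0∞ := fun m z =>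
    janossyExpectation ν (fun n x => J n m x z) (A.indicator fun _ => 1) with hNdef
  have hr : ∀ m z, janossyExpectation ν (fun n x => J n m x z / D m z) (A.indicator fun _ => 1) =
      N m z / D m z := fun m z =>
    janossyExpectation_div _ (fun n => (h.measurable n m).comp measurable_prodMk_right) hind
  have hN : ∀ m, Measurable (N m) := measurable_janossyExpectation_right h.measurable hind
  have hNsymm : ∀ (m : ℕ) (σ : Equiv.Perm (Fin m)) (z : Fin m → E), N m (z ∘ σ) = N m z :=
    fun m σ z => janossyExpectation_congr fun n x => by
      simpa using h.symmetric n m (Equiv.refl _) σ x z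
  have hND : ∀ m z, N m z ≤ D m z := fun m z =>
    janossyExpectation_mono fun ξ => Set.indicator_le_self' (fun _ _ => zero_le_one) ξ
  obtain ⟨g, hg, hgr⟩ := exists_measurable_comp_config (r := fun m z => N m z / D m z)
    (fun m => (hN m).div (hD.measurable m)) fun m σ z => by
      simp only [hNsymm, hD.symmetric]
  have hkey : ∀ B : Set (Measure E), MeasurableSet B →
      ∫⁻ ω in Ξ ⁻¹' B, g (Ξ ω) ∂P = P (Φ ⁻¹' A ∩ Ξ ⁻¹' B) := by
    intro B hB
    have h1 : ∫⁻ ω in Ξ ⁻¹' B, g (Ξ ω) ∂P = ∫⁻ ω, B.indicator g (Ξ ω) ∂P := by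
      rw [← lintegral_indicator (hΞ hB)]
      rfl
    have h2 : P (Φ ⁻¹' A ∩ Ξ ⁻¹' B) =
        ∫⁻ ω, A.indicator (fun _ => 1) (Φ ω) * B.indicator (fun _ => 1) (Ξ ω) ∂P := by
      rw [← lintegral_indicator_one ((hΦ hA).inter (hΞ hB))]
      refine lintegral_congr fun ω => ?_
      by_cases h1 : Φ ω ∈ A <;> by_cases h2 : Ξ ω ∈ B <;> simp [h1, h2]
    rw [h1, h2, h.lintegral_mul_eq hind (measurable_const.indicator hB),
      hD.expectation _ (hg.indicator hB), janossyExpectation]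
    refine tsum_congr fun m => ?_
    congr 1
    refine lintegral_congr_ae ?_
    filter_upwards [hD.ae_ne_top m] with z hz
    by_cases hzB : config z ∈ B
    · rw [Set.indicator_of_mem hzB, Set.indicator_of_mem hzB, hgr, one_mul,
        ENNReal.div_mul_cancel' (fun h0 => le_antisymm (h0 ▸ hND m z) zero_le)
          (fun htop => absurd htop hz)]
    · rw [Set.indicator_of_notMem hzB, Set.indicator_of_notMem hzB, zero_mul, zero_mul]
  have hgΞ : Measurable fun ω => g (Ξ ω) := hg.comp hΞ
  have hfin : ∫⁻ ω, g (Ξ ω) ∂P ≠ ∞ := by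
    have := hkey Set.univ MeasurableSet.univ
    rw [Set.preimage_univ, Measure.restrict_univ] at this
    rw [this]
    exact measure_ne_top _ _
  have hcond : (fun ω => (g (Ξ ω)).toReal) =ᵐ[P]
      P⟦Φ ⁻¹' A | MeasurableSpace.comap Ξ inferInstance⟧ := by
    refine ae_eq_condExp_of_forall_setIntegral_eq hΞ.comap_le
      ((integrable_const _).indicator (hΦ hA)) ?_ ?_ ?_
    · exact fun s _ _ =>
        (integrable_toReal_of_lintegral_ne_top hgΞ.aemeasurable hfin).integrableOn
    · rintro s ⟨B, hB, rfl⟩ -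
      rw [integral_toReal hgΞ.aemeasurable (ae_restrict_of_ae (ae_lt_top hgΞ hfin)), hkey B hB,
        integral_indicator (hΦ hA), Measure.restrict_restrict (hΦ hA)]
      simp [Measure.real]
    · exact (hg.ennreal_toReal.comp (comap_measurable Ξ)).stronglyMeasurable.aestronglyMeasurable
  filter_upwards [hcond] with ω hω m z hz
  rw [← hω, hz, hgr, hr]

end Conditional

end PosteriorJanossy

end

theorem mainTheorem1 {Ω E : Type*} [MeasurableSpace Ω] [MeasurableSpace E] [StandardBorelSpace E]
    (P : Measure Ω) [IsProbabilityMeasure P] (ν : Measure E) [SigmaFinite ν]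
    (p : ℝ≥0∞) (hp : p ≤ 1)
    (l : E → E → ℝ≥0∞) (hl : Measurable (Function.uncurry l)) (hl1 : ∀ x, ∫⁻ z, l z x ∂ν = 1)
    (lc : E → ℝ≥0∞) (hlc : Measurable lc) (hlc_fin : ∫⁻ z, lc z ∂ν ≠ ∞)
    (Φ Ξ : Ω → Measure E) (hΦ : PosteriorJanossy.IsPointProcess P Φ)
    (j : ∀ n : ℕ, (Fin n → E) → ℝ≥0∞) (hj : PosteriorJanossy.HasJanossyDensities P ν Φ j)
    (hΞ : PosteriorJanossy.IsMeasurementProcess P ν p l lc Φ Ξ) :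
    PosteriorJanossy.HasCondJanossyDensities P ν Φ Ξ
        (fun n m x z => PosteriorJanossy.jointJanossy ν p l lc j n m x z /
          PosteriorJanossy.measurementJanossy ν p l lc j m z) ∧
      PosteriorJanossy.HasJointJanossyDensities P ν Φ Ξ
        (PosteriorJanossy.jointJanossy ν p l lc j) ∧
      PosteriorJanossy.HasJanossyDensities P ν Ξ
        (PosteriorJanossy.measurementJanossy ν p l lc j) := by
  have hjoint : PosteriorJanossy.HasJointJanossyDensities P ν Φ Ξ
      (PosteriorJanossy.jointJanossy ν p l lc j) := by
    refine ⟨fun n m => ?_, fun n m σ τ x z => ?_, fun F hF => ?_⟩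
    · have h := ((hj.measurable n).comp measurable_fst).mul
        (PosteriorJanossy.measurable_measurementKernel (ν := ν) (p := p) hl hlc n m)
      convert h using 1
      funext y
      exact PosteriorJanossy.jointJanossy_eq j n m y.1 y.2
    · rw [PosteriorJanossy.jointJanossy_eq, PosteriorJanossy.jointJanossy_eq,
        PosteriorJanossy.measurementKernel_comp_perm, hj.symmetric]
    · exact PosteriorJanossy.lintegral_of_isMeasurementProcess hp hl hl1 hlc hlc_fin hΦ.measurable
        hj hΞ hF
  have hD : PosteriorJanossy.measurementJanossy ν p l lc j = fun m z =>
      PosteriorJanossy.janossyExpectation ν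
        (fun n x => PosteriorJanossy.jointJanossy ν p l lc j n m x z) fun _ => 1 := by
    funext m z
    exact PosteriorJanossy.measurementJanossy_eq_janossyExpectation hl hj.measurable hj.symmetric
      m z
  rw [hD]
  exact ⟨hjoint.hasCondJanossyDensities hΦ.measurable
    (PosteriorJanossy.measurable_of_isMeasurementProcess hΞ), hjoint,
    hjoint.hasJanossyDensities_snd⟩
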